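/- Let $n\ge 2$ and write $\overline{\mathbb R^n}=\mathbb R^n\cup\{\infty\}$, with the chordal metric $h(x,y)=\frac{|x-y|}{\sqrt{1+|x|^2}\sqrt{1+|y|^2}}$, $h(x,\infty)=\frac1{\sqrt{1+|x|^2}}$ for $x,y\in\mathbb R^n$; for sets put $h(A,B)=\inf_{x\in A,\,y\in B}h(x,y)$ (with $\inf\varnothing=\infty$). A domain is a nonempty open connected subset of $\mathbb R^n$, and the boundary $\partial D$ of a domain $D$ is taken in $\overline{\mathbb R^n}$. Put $S(y_0,r)=\{y\in\mathbb R^n:|y-y_0|=r\}$ and $A(y_0,r_1,r_2)=\{y\in\mathbb R^n:r_1<|y-y_0|<r_2\}$. For a family $\Gamma$ of paths in $\mathbb R^n$, let $M(\Gamma)=\inf_\rho\int_{\mathbb R^n}\rho^n\,dm$ be its conformal modulus, the infimum being over all Borel $\rho:\mathbb R^n\to[0,\infty]$ with $\int_\gamma\rho\,|dx|\ge1$ for every locally rectifiable $\gamma\in\Gamma$. For a domain $D$ and $f:D\to\mathbb R^n$, let $\Gamma_f(y_0,r_1,r_2)$ be the family of all paths $\gamma:[a,b]\to D$ with $f(\gamma(a))\in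 S(y_0,r_1)$, $f(\gamma(b))\in S(y_0,r_2)$ and $f(\gamma(t))\in A(y_0,r_1,r_2)$ for $t\in(a,b)$. Let $\delta>0$, let $D,D_0\subset\mathbb R^n$ be domains, let $E\subset D_0$ be a nonempty compact set, and let $Q:\mathbb R^n\to[0,\infty]$ be a Lebesgue measurable function that vanishes outside $D_0$. Let $\mathfrak F^E_{Q,\delta}(D,D_0)$ be the class of all continuous, open, discrete mappings $f:D\to D_0$ of $D$ onto a domain $f(D)$ with $E\subset f(D)\subset D_0$ that are closed as mappings onto $f(D)$, satisfy $h(f^{-1}(E),\partial D)\ge\delta$, and satisfy $$M(\Gamma_f(y_0,r_1,r_2))\le\int_{A(y_0,r_1,r_2)\cap f(D)}Q(y)\,\eta^n(|y-y_0|)\,dm(y)$$ for every $y_0\in\overline{D_0}$ (closure in $\mathbb R^n$), all $0<r_1<r_2<\sup_{y\in f(D)}|y-y_0|$ and every Lebesgue measurable $\eta:(r_1,r_2)\to[0,\infty]$ with $\int_{r_1}^{r_2}\eta(r)\,dr\ge1$. Let $f_m\in\mathfrak F^E_{Q,\delta}(D,D_0)$, $m=1,2,\ldots$. Assume: (1)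 no connected component of $\partial D$ is a single point; (2) the domains $f_m(D)$ converge to $D_0$ as their kernel with respect to some point $A_0$; that is, some ball centred at $A_0$ lies in all $f_m(D)$, and for every subsequence $f_{m_k}(D)$, $D_0$ is the largest domain $G$ containing $A_0$ such that each compact subset of $G$ lies in $f_{m_k}(D)$ for all sufficiently large $k$; (3) for every $y_0\in\overline{D_0}$ (closure in $\mathbb R^n$) and all $0<r_1<r_2<\sup_{y\in D_0}|y-y_0|$ there is a set $E_1\subset[r_1,r_2]$ of positive linear Lebesgue measure such that $Q$ is integrable over $S(y_0,r)$ with respect to the Hausdorff measure $\mathcal H^{n-1}$ for every $r\in E_1$. Then for every compact set $E_*\subset D_0$ with $E_*\subset f_m(D)$ for all $m$ there is $\delta_*>0$ such that $h(f_m^{-1}(E_*),\partial D)\ge\delta_*$ for every $m=1,2,\ldots$. -/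

import Mathlib

open MeasureTheory Set
open scoped ENNReal

noncomputable section

namespace InversePoletsky

/-- The Euclidean space `ℝⁿ`. -/
abbrev Rn (n : ℕ) : Type := EuclideanSpace ℝ (Fin n)

/-- The extended space `ℝⁿ ∪ {∞}` with the topology of the one-point compactification. -/
abbrev RnExt (n : ℕ) : Type := OnePoint (Rn n)

/-- A domain in `ℝⁿ`: a nonempty open connected set. -/
def IsDom {n : ℕ} (D : Set (Rn n)) : Prop := IsOpen D ∧ IsConnected D

/-! ### The chordal metric and boundaries in the extended space -/

/-- The spherical (chordal) distance `h` on `ℝⁿ ∪ {∞}`. -/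
def chordal {n : ℕ} : RnExt n → RnExt n → ℝ
  | .infty, .infty => 0
  | .some x, .infty => 1 / √(1 + ‖x‖ ^ 2)
  | .infty, .some y => 1 / √(1 + ‖y‖ ^ 2)
  | .some x, .some y => ‖x - y‖ / (√(1 + ‖x‖ ^ 2) * √(1 + ‖y‖ ^ 2))

/-- `h(A, B) = inf {h(x, y) : x ∈ A, y ∈ B}`, equal to `∞` if `A` or `B` is empty. -/
def chordalDist {n : ℕ} (A B : Set (RnExt n)) : ℝ≥0∞ :=
  ⨅ x ∈ A, ⨅ y ∈ B, ENNReal.ofReal (chordal x y)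

/-- A subset of `ℝⁿ` regarded as a subset of the extended space. -/
def toExt {n : ℕ} (D : Set (Rn n)) : Set (RnExt n) := (fun x : Rn n => (x : RnExt n)) '' D

/-- The boundary of `D ⊆ ℝⁿ`, taken in the extended space (so `∞` belongs to it exactly
when `D` is unbounded). -/
def extBoundary {n : ℕ} (D : Set (Rn n)) : Set (RnExt n) := frontier (toExt D)

/-- No connected component of the boundary of `D` is a single point. -/
def BoundaryNondegenerate {n : ℕ} (D : Set (Rn n)) : Prop :=
  ∀ x ∈ extBoundary D, connectedComponentIn (extBoundary D) x ≠ {x}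

/-! ### Paths and the modulus of a family of paths -/

/-- A path `γ : [a, b] → ℝⁿ`; the values of `toFun` outside `[a, b]` play no role. -/
structure ClosedPath (n : ℕ) where
  /-- left end of the parameter interval -/
  a : ℝ
  /-- right end of the parameter interval -/
  b : ℝ
  lt : a < b
  /-- the parametrization -/
  toFun : ℝ → Rn n
  cont : ContinuousOn toFun (Icc a b)

/-- The length of a path. -/
def ClosedPath.length {n : ℕ} (γ : ClosedPath n) : ℝ≥0∞ := eVariationOn γ.toFun (Icc γ.a γ.b)

/-- A path is rectifiable if its length is finite (for paths on compact intervals this is the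
same as local rectifiability). -/
def ClosedPath.Rectifiable {n : ℕ} (γ : ClosedPath n) : Prop := γ.length ≠ ∞

/-- The integral `∫_γ ρ |dx| = ∫₀^ℓ ρ(γ⁰(s)) ds` of `ρ` along a rectifiable path `γ` of length
`ℓ`, where `γ⁰ : [0, ℓ] → ℝⁿ` is the parametrization of `γ` by arc length. -/
def ClosedPath.lineIntegral {n : ℕ} (γ : ClosedPath n) (ρ : Rn n → ℝ≥0∞) : ℝ≥0∞ :=
  ∫⁻ s in Icc 0 γ.length.toReal, ρ (naturalParameterization γ.toFun (Icc γ.a γ.b) γ.a s)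

/-- `ρ ∈ adm Γ`: `ρ : ℝⁿ → [0, ∞]` is Borel and `∫_γ ρ |dx| ≥ 1` for every (locally) rectifiable
`γ ∈ Γ`. -/
def Admissible {n : ℕ} (Γ : Set (ClosedPath n)) (ρ : Rn n → ℝ≥0∞) : Prop :=
  Measurable ρ ∧ ∀ γ ∈ Γ, γ.Rectifiable → 1 ≤ γ.lineIntegral ρ

/-- The conformal modulus `M(Γ) = M_n(Γ) = inf {∫ ρⁿ dm : ρ ∈ adm Γ}`. -/
def modulus {n : ℕ} (Γ : Set (ClosedPath n)) : ℝ≥0∞ :=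
  ⨅ ρ : Rn n → ℝ≥0∞, ⨅ _ : Admissible Γ ρ, ∫⁻ x, ρ x ^ n

/-! ### The inverse Poletsky inequality -/

/-- The open spherical ring `A(y₀, r₁, r₂)`. -/
def sphericalRing {n : ℕ} (y₀ : Rn n) (r₁ r₂ : ℝ) : Set (Rn n) := {y | r₁ < dist y y₀ ∧ dist y y₀ < r₂}

/-- `Γ_f(y₀, r₁, r₂)`: the paths `γ : [a, b] → D` such that `f ∘ γ` starts on `S(y₀, r₁)`, ends on
`S(y₀, r₂)`, and lies in the ring `A(y₀, r₁, r₂)` for parameters in `(a, b)`. -/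
def liftedRingPaths {n : ℕ} (D : Set (Rn n)) (f : Rn n → Rn n) (y₀ : Rn n) (r₁ r₂ : ℝ) :
    Set (ClosedPath n) :=
  {γ | (∀ t ∈ Icc γ.a γ.b, γ.toFun t ∈ D) ∧
    f (γ.toFun γ.a) ∈ Metric.sphere y₀ r₁ ∧ f (γ.toFun γ.b) ∈ Metric.sphere y₀ r₂ ∧
    ∀ t ∈ Ioo γ.a γ.b, f (γ.toFun t) ∈ sphericalRing y₀ r₁ r₂}

/-- `f : D → ℝⁿ` satisfies the inverse Poletsky inequality with weight `Q` at `y₀`. -/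
def InversePoletskyAt {n : ℕ} (D : Set (Rn n)) (Q : Rn n → ℝ≥0∞) (f : Rn n → Rn n)
    (y₀ : Rn n) : Prop :=
  ∀ r₁ r₂ : ℝ, 0 < r₁ → r₁ < r₂ → ENNReal.ofReal r₂ < ⨆ y ∈ f '' D, edist y y₀ →
    ∀ η : ℝ → ℝ≥0∞, AEMeasurable η (volume.restrict (Ioo r₁ r₂)) →
      1 ≤ ∫⁻ r in Ioo r₁ r₂, η r →
      modulus (liftedRingPaths D f y₀ r₁ r₂) ≤
        ∫⁻ y in sphericalRing y₀ r₁ r₂ ∩ f '' D, Q y * η (dist y y₀) ^ n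

/-! ### Open, discrete and closed mappings and the class `𝔉` -/

/-- `f` is open on the open set `D`. -/
def OpenMapOn {n : ℕ} (D : Set (Rn n)) (f : Rn n → Rn n) : Prop :=
  ∀ U ⊆ D, IsOpen U → IsOpen (f '' U)

/-- Each fibre of `f : D → ℝⁿ` consists of isolated points. -/
def DiscreteMapOn {n : ℕ} (D : Set (Rn n)) (f : Rn n → Rn n) : Prop :=
  ∀ y, IsDiscrete (D ∩ f ⁻¹' {y})

/-- `f` maps relatively closed subsets of `D` to relatively closed subsets of `f(D)`. -/
def ClosedMapOn {n : ℕ} (D : Set (Rn n)) (f : Rn n → Rn n) : Prop :=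
  ∀ A, IsClosed A → ∃ C, IsClosed C ∧ f '' (D ∩ A) = f '' D ∩ C

/-- Membership in the class `𝔉^E_{Q,δ}(D, D₀)`. Mappings are continuous, and only the values of `f`
on `D` play a role. -/
structure MemClass {n : ℕ} (E : Set (Rn n)) (Q : Rn n → ℝ≥0∞) (δ : ℝ) (D D₀ : Set (Rn n))
    (f : Rn n → Rn n) : Prop where
  continuousOn : ContinuousOn f D
  openMap : OpenMapOn D f
  discrete : DiscreteMapOn D f
  closedMap : ClosedMapOn D f
  isDom_image : IsDom (f '' D)
  subset_image : E ⊆ f '' D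
  image_subset : f '' D ⊆ D₀
  poletsky : ∀ y₀ ∈ closure D₀, InversePoletskyAt D Q f y₀
  dist_preimage : ENNReal.ofReal δ ≤ chordalDist (toExt (D ∩ f ⁻¹' E)) (extBoundary D)

/-! ### Kernels of sequences of domains -/

/-- `G` is a domain containing `A₀`, each compact subset of which lies in all but finitely many
of the `Dseq m`. -/
def IsKernelCandidate {n : ℕ} (Dseq : ℕ → Set (Rn n)) (A₀ : Rn n) (G : Set (Rn n)) : Prop :=
  IsDom G ∧ A₀ ∈ G ∧ ∀ K ⊆ G, IsCompact K → ∃ N, ∀ m ≥ N, K ⊆ Dseq m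

/-- `D₀` is the kernel of the sequence of domains `Dseq` with respect to `A₀`. -/
def IsKernel {n : ℕ} (Dseq : ℕ → Set (Rn n)) (A₀ : Rn n) (D₀ : Set (Rn n)) : Prop :=
  (∃ ρ > 0, ∀ m, Metric.ball A₀ ρ ⊆ Dseq m) ∧
    IsKernelCandidate Dseq A₀ D₀ ∧ ∀ G, IsKernelCandidate Dseq A₀ G → G ⊆ D₀

/-- `Dseq` converges to the kernel `D₀`: every subsequence has `D₀` as its kernel. -/
def ConvergesToKernel {n : ℕ} (Dseq : ℕ → Set (Rn n)) (A₀ : Rn n) (D₀ : Set (Rn n)) : Prop :=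
  ∀ φ : ℕ → ℕ, StrictMono φ → IsKernel (fun k => Dseq (φ k)) A₀ D₀

/-! ### Integrability over spheres -/

/-- For every `y₀` in the closure of `D₀` and all `0 < r₁ < r₂ < sup {|y - y₀| : y ∈ D₀}`, the
function `Q` is integrable over `S(y₀, r)` with respect to the `(n-1)`-dimensional Hausdorff measure
for all `r` in some subset of `[r₁, r₂]` of positive Lebesgue measure. -/
def IntegrableOnManySpheres {n : ℕ} (Q : Rn n → ℝ≥0∞) (D₀ : Set (Rn n)) : Prop :=
  ∀ y₀ ∈ closure D₀, ∀ r₁ r₂ : ℝ, 0 < r₁ → r₁ < r₂ →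
    ENNReal.ofReal r₂ < ⨆ y ∈ D₀, edist y y₀ →
    ∃ E₁ ⊆ Icc r₁ r₂, 0 < volume E₁ ∧ ∀ r ∈ E₁,
      AEMeasurable Q ((Measure.hausdorffMeasure ((n : ℝ) - 1)).restrict (Metric.sphere y₀ r)) ∧
      ∫⁻ y in Metric.sphere y₀ r, Q y ∂(Measure.hausdorffMeasure ((n : ℝ) - 1)) < ∞

end InversePoletsky

end

open InversePoletsky

/-!
Since no component of `∂D` is a point, all small spheres about a finite boundary point, and all
large spheres if `∞ ∈ ∂D`, contain points outside `D`. Enlarge `E_*` to a connected compact set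
`G ⊆ D₀` containing a point `e` of `E`. As `f` is open and closed, every component of `f⁻¹(G)` maps
onto `G` and so meets `f⁻¹(e)`, which stays away from `∂D`. If `f⁻¹(G)` came close to `∂D`, it
would therefore meet every sphere of a thick ring `a < |z - x| < q a`, and each of these spheres
would also contain a point outside `D`.

On the one hand, the paths in these spheres that join the two kinds of points have modulus at least
`c log q`. On the other hand, a path in `D` from `f⁻¹(G)` to `∂D` has an image that starts in `G`
and leaves each compact subset of `f(D)`, so it crosses one of finitely many rings `A(y, r, 2r)`
with `y ∈ D₀` whose inner balls cover `G`. Integrability of `Q` over many spheres yields a weight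
`η` for which the inverse Poletsky inequality bounds the modulus of the lifts of such crossings by a
finite constant that does not depend on `f`. Hence `q` is bounded uniformly in `f`, which proves the
claim as soon as `f_m(D)` contains the finitely many closed balls involved and `G`; the other `m`
are finite in number, and for each of them the preimage of `E_*` is compact.
-/

open MeasureTheory Set Filter Topology NormedSpace
open scoped ENNReal NNReal

namespace InversePoletsky

/-! ### Chordal distance and the extended boundary -/

/-- The inverse stereographic projection of `ℝⁿ ∪ {∞}` onto the sphere of diameter `1` in
`ℝⁿ × ℝ` tangent to `ℝⁿ`, with `∞` sent to the origin. The chordal metric is the distance between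
the images. -/
noncomputable def stereo {n : ℕ} (x : RnExt n) : Rn n × ℝ :=
  x.elim 0 fun x => ((1 + ‖x‖ ^ 2)⁻¹ • x, (1 + ‖x‖ ^ 2)⁻¹)

theorem continuous_stereo {n : ℕ} : Continuous (stereo (n := n)) := by
  refine (OnePoint.continuous_iff _).2 ⟨?_, ?_⟩
  · rw [coclosedCompact_eq_cocompact]
    have hnorm := tendsto_norm_cocompact_atTop (E := Rn n)
    have hle (x : Rn n) : ‖(1 + ‖x‖ ^ 2)⁻¹ • x‖ ≤ ‖x‖⁻¹ := by
      rw [norm_smul, Real.norm_of_nonneg (by positivity)]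
      rcases (norm_nonneg x).eq_or_lt with h | h
      · simp [← h]
      · rw [inv_mul_le_iff₀ (by positivity)]
        field_simp
        linarith
    exact (squeeze_zero_norm hle (tendsto_inv_atTop_zero.comp hnorm)).prodMk_nhds
      (tendsto_inv_atTop_zero.comp
        (tendsto_atTop_add_const_left _ _ ((tendsto_pow_atTop two_ne_zero).comp hnorm)))
  · have hpos (x : Rn n) : 1 + ‖x‖ ^ 2 ≠ 0 := by positivity
    change Continuous fun x : Rn n => ((1 + ‖x‖ ^ 2)⁻¹ • x, (1 + ‖x‖ ^ 2)⁻¹)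
    fun_prop (disch := exact hpos _)

theorem chordal_eq_sqrt {n : ℕ} (x y : RnExt n) :
    chordal x y = √(‖(stereo x).1 - (stereo y).1‖ ^ 2 + ((stereo x).2 - (stereo y).2) ^ 2) := by
  have to_infty (x : Rn n) : 1 / √(1 + ‖x‖ ^ 2)
      = √(‖(1 + ‖x‖ ^ 2)⁻¹ • x‖ ^ 2 + ((1 + ‖x‖ ^ 2)⁻¹) ^ 2) := by
    rw [norm_smul, Real.norm_of_nonneg (by positivity), one_div, ← Real.sqrt_inv]
    congr 1
    field_simp
    ring
  induction x using OnePoint.rec <;> induction y using OnePoint.rec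
  case infty.infty => simp [chordal]
  case infty.coe y => exact (to_infty y).trans (by simp [stereo])
  case coe.infty x => exact (to_infty x).trans (by simp [stereo])
  case coe.coe x y =>
    change ‖x - y‖ / (√(1 + ‖x‖ ^ 2) * √(1 + ‖y‖ ^ 2)) =
      √(‖(1 + ‖x‖ ^ 2)⁻¹ • x - (1 + ‖y‖ ^ 2)⁻¹ • y‖ ^ 2 + ((1 + ‖x‖ ^ 2)⁻¹ - (1 + ‖y‖ ^ 2)⁻¹) ^ 2)
    rw [← Real.sqrt_mul (by positivity), ← Real.sqrt_sq (norm_nonneg (x - y)),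
      ← Real.sqrt_div (by positivity)]
    congr 1
    rw [norm_sub_sq_real, norm_sub_sq_real, norm_smul, norm_smul, real_inner_smul_left,
      real_inner_smul_right, Real.norm_of_nonneg (by positivity),
      Real.norm_of_nonneg (by positivity)]
    field_simp
    ring

theorem continuous_chordal {n : ℕ} : Continuous fun p : RnExt n × RnExt n => chordal p.1 p.2 := by
  simp only [chordal_eq_sqrt]
  have := continuous_stereo (n := n)
  fun_prop

theorem chordal_self {n : ℕ} (x : RnExt n) : chordal x x = 0 := by
  simp [chordal_eq_sqrt]

theorem chordal_pos {n : ℕ} {x y : RnExt n} (h : x ≠ y) : 0 < chordal x y := by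
  induction x using OnePoint.rec <;> induction y using OnePoint.rec
  case infty.infty => exact absurd rfl h
  case infty.coe y => change 0 < 1 / √(1 + ‖y‖ ^ 2); positivity
  case coe.infty x => change 0 < 1 / √(1 + ‖x‖ ^ 2); positivity
  case coe.coe x y =>
    have : 0 < ‖x - y‖ := norm_sub_pos_iff.2 fun hxy => h (by rw [hxy])
    change 0 < ‖x - y‖ / (√(1 + ‖x‖ ^ 2) * √(1 + ‖y‖ ^ 2))
    positivity

theorem exists_pos_le_chordalDist {n : ℕ} {A B : Set (RnExt n)} (hA : IsCompact A)
    (hB : IsCompact B) (hAB : Disjoint A B) :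
    ∃ δ : ℝ, 0 < δ ∧ ENNReal.ofReal δ ≤ chordalDist A B := by
  obtain hE | hne := (A ×ˢ B).eq_empty_or_nonempty
  · refine ⟨1, one_pos, le_iInf₂ fun x hx => le_iInf₂ fun y hy => ?_⟩
    exact absurd (mk_mem_prod hx hy) (by simp [hE])
  · obtain ⟨p, hp, hmin⟩ := (hA.prod hB).exists_isMinOn hne continuous_chordal.continuousOn
    refine ⟨chordal p.1 p.2, chordal_pos (hAB.ne_of_mem hp.1 hp.2),
      le_iInf₂ fun x hx => le_iInf₂ fun y hy => ?_⟩
    exact ENNReal.ofReal_le_ofReal (hmin (mk_mem_prod hx hy))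

theorem chordalDist_mono {n : ℕ} {A A' : Set (RnExt n)} (h : A ⊆ A') (B : Set (RnExt n)) :
    chordalDist A' B ≤ chordalDist A B :=
  biInf_mono h

theorem eventually_notMem_of_le_chordalDist {n : ℕ} {B : Set (RnExt n)} {b : RnExt n} (hb : b ∈ B)
    {δ : ℝ} (hδ : 0 < δ) :
    ∀ᶠ x in 𝓝 b, ∀ A : Set (RnExt n), ENNReal.ofReal δ ≤ chordalDist A B → x ∉ A := by
  have hcont : Continuous fun x => chordal x b :=
    continuous_chordal.comp (continuous_id.prodMk continuous_const)
  have hclose : ∀ᶠ x in 𝓝 b, chordal x b < δ :=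
    hcont.continuousAt.eventually (gt_mem_nhds (by simpa [chordal_self] using hδ))
  filter_upwards [hclose] with x hx A hA hxA
  have hle : ENNReal.ofReal δ ≤ ENNReal.ofReal (chordal x b) :=
    hA.trans ((iInf₂_le x hxA).trans (iInf₂_le b hb))
  exact hle.not_gt ((ENNReal.ofReal_lt_ofReal_iff hδ).2 hx)

theorem coe_mem_toExt {n : ℕ} {s : Set (Rn n)} {x : Rn n} : (x : RnExt n) ∈ toExt s ↔ x ∈ s :=
  OnePoint.coe_injective.mem_set_image

theorem isOpen_toExt {n : ℕ} {s : Set (Rn n)} (hs : IsOpen s) : IsOpen (toExt s) :=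
  OnePoint.isOpen_image_coe.2 hs

theorem disjoint_toExt_extBoundary {n : ℕ} {D : Set (Rn n)} (hD : IsOpen D) :
    Disjoint (toExt D) (extBoundary D) :=
  (disjoint_frontier_iff_isOpen.2 (isOpen_toExt hD)).symm

theorem isOpen_compl_toExt {n : ℕ} {s : Set (Rn n)} (hs : IsCompact s) : IsOpen (toExt s)ᶜ :=
  OnePoint.isOpen_compl_image_coe.2 ⟨hs.isClosed, hs⟩

theorem closure_toExt_ball_subset {n : ℕ} (x : Rn n) (r : ℝ) :
    closure (toExt (Metric.ball x r)) ⊆ toExt (Metric.closedBall x r) :=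
  closure_minimal (image_mono Metric.ball_subset_closedBall)
    (isOpen_compl_iff.1 (isOpen_compl_toExt (isCompact_closedBall x r)))

theorem exists_mem_sphere_notMem_of_isPreconnected {n : ℕ} {D : Set (Rn n)} (hD : IsOpen D)
    {K : Set (RnExt n)} (hK : IsPreconnected K) (hKD : K ⊆ extBoundary D) {x : Rn n} {r : ℝ}
    (hin : (K ∩ toExt (Metric.ball x r)).Nonempty) (hout : ¬K ⊆ toExt (Metric.ball x r)) :
    ∃ k ∈ Metric.sphere x r, k ∉ D := by
  by_contra! hsphere
  refine hout (hK.subset_of_closure_inter_subset (isOpen_toExt Metric.isOpen_ball) hin ?_)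
  rintro z ⟨hz, hzK⟩
  obtain ⟨k, hk, rfl⟩ := closure_toExt_ball_subset x r hz
  have hkD : k ∉ D := fun h => (disjoint_toExt_extBoundary hD).ne_of_mem
    (coe_mem_toExt.2 h) (hKD hzK) rfl
  exact coe_mem_toExt.2 (hk.lt_of_ne fun h => hkD (hsphere k h))

theorem BoundaryNondegenerate.exists_ne {n : ℕ} {D : Set (Rn n)} (h : BoundaryNondegenerate D)
    {x : RnExt n} (hx : x ∈ extBoundary D) :
    ∃ y ∈ connectedComponentIn (extBoundary D) x, y ≠ x := by
  by_contra! hsub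
  exact h x hx (Subset.antisymm hsub (singleton_subset_iff.2 (mem_connectedComponentIn hx)))

theorem BoundaryNondegenerate.exists_forall_lt_sphere {n : ℕ} {D : Set (Rn n)}
    (h : BoundaryNondegenerate D) (hD : IsOpen D) {x : Rn n} (hx : (x : RnExt n) ∈ extBoundary D) :
    ∃ R > 0, ∀ r, 0 < r → r < R → ∃ k ∈ Metric.sphere x r, k ∉ D := by
  obtain ⟨y, hy, hne⟩ := h.exists_ne hx
  obtain ⟨R, hR, hRy⟩ : ∃ R > 0, ∀ r < R, y ∉ toExt (Metric.ball x r) := by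
    induction y using OnePoint.rec with
    | infty => exact ⟨1, one_pos, fun r _ => OnePoint.infty_notMem_image_coe⟩
    | coe y =>
      refine ⟨dist y x, dist_pos.2 fun h => hne (by rw [h]), fun r hr hmem => ?_⟩
      exact (coe_mem_toExt.1 hmem).not_ge hr.le
  exact ⟨R, hR, fun r hr0 hr => exists_mem_sphere_notMem_of_isPreconnected hD
    isPreconnected_connectedComponentIn (connectedComponentIn_subset _ _)
    ⟨x, mem_connectedComponentIn hx, coe_mem_toExt.2 (Metric.mem_ball_self hr0)⟩
    fun hsub => hRy r hr (hsub hy)⟩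

theorem BoundaryNondegenerate.exists_forall_gt_sphere {n : ℕ} {D : Set (Rn n)}
    (h : BoundaryNondegenerate D) (hD : IsOpen D)
    (hinfty : (OnePoint.infty : RnExt n) ∈ extBoundary D) (x : Rn n) :
    ∃ R > 0, ∀ r, R < r → ∃ k ∈ Metric.sphere x r, k ∉ D := by
  obtain ⟨y, hy, hne⟩ := h.exists_ne hinfty
  obtain ⟨y, rfl⟩ := OnePoint.ne_infty_iff_exists.1 hne
  refine ⟨dist y x + 1, by positivity, fun r hr => ?_⟩
  exact exists_mem_sphere_notMem_of_isPreconnected hD isPreconnected_connectedComponentIn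
    (connectedComponentIn_subset _ _)
    ⟨y, hy, coe_mem_toExt.2 (by rw [Metric.mem_ball]; linarith)⟩
    fun hsub => OnePoint.infty_notMem_image_coe (hsub (mem_connectedComponentIn hinfty))

/-! ### Polar coordinates and spherical weights -/

section Polar

variable {V : Type*} [NormedAddCommGroup V] [NormedSpace ℝ V] [MeasurableSpace V] [BorelSpace V]
  {g : V → ℝ≥0∞}

theorem measurable_comp_add_smul (hg : Measurable g) (x : V) (r : ℝ) :
    Measurable fun θ : Metric.sphere (0 : V) 1 => g (x + r • (θ : V)) :=
  hg.comp (by fun_prop)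

theorem map_add_smul_hausdorffMeasure_le (y : V) {r : ℝ} (hr : 0 < r) {d : ℝ} (hd : 0 ≤ d) :
    (Measure.hausdorffMeasure d).map (fun θ : Metric.sphere (0 : V) 1 => y + r • (θ : V)) ≤
      ENNReal.ofReal r⁻¹ ^ d • (Measure.hausdorffMeasure d).restrict (Metric.sphere y r) := by
  set φ : Metric.sphere (0 : V) 1 → V := fun θ => y + r • (θ : V)
  have hanti : AntilipschitzWith (Real.toNNReal r⁻¹) φ := .of_le_mul_dist fun θ θ' => by
    rw [Real.coe_toNNReal _ (by positivity), dist_add_left, dist_smul₀,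
      Real.norm_of_nonneg hr.le, inv_mul_cancel_left₀ hr.ne']
    rfl
  have hmaps (θ : Metric.sphere (0 : V) 1) : φ θ ∈ Metric.sphere y r := by
    simp [φ, norm_smul, abs_of_pos hr]
  refine Measure.le_iff.2 fun s hs => ?_
  have hpre : φ ⁻¹' s = φ ⁻¹' (s ∩ Metric.sphere y r) := by
    rw [preimage_inter, (eq_univ_of_forall hmaps : φ ⁻¹' Metric.sphere y r = univ), inter_univ]
  rw [Measure.map_apply (by fun_prop) hs, hpre, Measure.smul_apply, Measure.restrict_apply hs]
  exact hanti.hausdorffMeasure_preimage_le hd _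

variable [FiniteDimensional ℝ V] (μ : Measure V) [μ.IsAddHaarMeasure]

theorem measurable_lintegral_toSphere (hg : Measurable g) (x : V) :
    Measurable fun r : ℝ => ∫⁻ θ, g (x + r • (θ : V)) ∂μ.toSphere := by
  have : Measurable fun p : ℝ × Metric.sphere (0 : V) 1 => g (x + p.1 • (p.2 : V)) :=
    hg.comp (by fun_prop)
  exact this.lintegral_prod_right'

variable [Nontrivial V]

theorem lintegral_eq_lintegral_toSphere (hg : Measurable g) (x : V) :
    ∫⁻ y, g y ∂μ = ∫⁻ r in Ioi (0 : ℝ), ENNReal.ofReal (r ^ (Module.finrank ℝ V - 1)) *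
      ∫⁻ θ, g (x + r • (θ : V)) ∂μ.toSphere := by
  set F : Metric.sphere (0 : V) 1 × Ioi (0 : ℝ) → ℝ≥0∞ :=
    fun p => g (x + (p.2 : ℝ) • (p.1 : V))
  have hF : Measurable F := hg.comp (by fun_prop)
  set d := Module.finrank ℝ V
  calc ∫⁻ y, g y ∂μ = ∫⁻ y in {0}ᶜ, g (x + y) ∂μ := by
        rw [restrict_compl_singleton, lintegral_add_left_eq_self g x]
    _ = ∫⁻ y : ({0}ᶜ : Set V), F (homeomorphUnitSphereProd V y) ∂(μ.comap Subtype.val) := by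
      rw [← lintegral_subtype_comap (measurableSet_singleton _).compl fun y => g (x + y)]
      refine lintegral_congr fun y => ?_
      simp only [F, homeomorphUnitSphereProd_apply_snd_coe, homeomorphUnitSphereProd_apply_fst_coe]
      rw [smul_inv_smul₀ (norm_ne_zero_iff.2 y.2)]
    _ = ∫⁻ r : Ioi (0 : ℝ), ∫⁻ θ, F (θ, r) ∂μ.toSphere ∂(Measure.volumeIoiPow (d - 1)) := by
      rw [μ.measurePreserving_homeomorphUnitSphereProd.lintegral_comp hF,
        lintegral_prod_symm' F hF]
    _ = ∫⁻ r : Ioi (0 : ℝ), ENNReal.ofReal ((r : ℝ) ^ (d - 1)) * ∫⁻ θ, F (θ, r) ∂μ.toSphere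
          ∂(volume.comap Subtype.val) := by
      rw [Measure.volumeIoiPow, lintegral_withDensity_eq_lintegral_mul _ (by fun_prop)
        hF.lintegral_prod_left']
      rfl
    _ = _ := lintegral_subtype_comap measurableSet_Ioi fun r : ℝ =>
        ENNReal.ofReal (r ^ (d - 1)) * ∫⁻ θ, g (x + r • (θ : V)) ∂μ.toSphere

theorem ae_ae_toSphere_mem {s : Set V} (hs : ∀ᵐ y ∂μ, y ∈ s) (x : V) :
    ∀ᵐ r ∂volume.restrict (Ioi (0 : ℝ)), ∀ᵐ θ : Metric.sphere (0 : V) 1 ∂μ.toSphere,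
      x + r • (θ : V) ∈ s := by
  obtain ⟨Z, hZs, hZmeas, hZ⟩ := exists_measurable_superset_of_null hs
  have hind : Measurable (Z.indicator (1 : V → ℝ≥0∞)) := measurable_one.indicator hZmeas
  have hmeas : Measurable fun r : ℝ => ENNReal.ofReal (r ^ (Module.finrank ℝ V - 1)) *
      ∫⁻ θ, Z.indicator (1 : V → ℝ≥0∞) (x + r • (θ : V)) ∂μ.toSphere :=
    (by fun_prop : Measurable fun r : ℝ => ENNReal.ofReal (r ^ (Module.finrank ℝ V - 1))).mul
      (measurable_lintegral_toSphere μ hind x)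
  have hpolar := lintegral_eq_lintegral_toSphere μ hind x
  rw [lintegral_indicator_one hZmeas, hZ, eq_comm, lintegral_eq_zero_iff hmeas] at hpolar
  filter_upwards [hpolar, ae_restrict_mem measurableSet_Ioi] with r hr (hr0 : 0 < r)
  have hmean := (mul_eq_zero.1 hr).resolve_left
    (ENNReal.ofReal_pos.2 (pow_pos hr0 _)).ne'
  rw [lintegral_eq_zero_iff (measurable_comp_add_smul hind x r)] at hmean
  filter_upwards [hmean] with θ hθ
  by_contra hns
  simp [indicator_of_mem (hZs hns)] at hθ

-- The ball about `p` of radius `2 d` contains the sector `{r θ | θ ∈ A, 1 < r < 1 + d}`.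
theorem ofReal_mul_toSphere_closedBall_le (p : V) (d : ℝ) :
    ENNReal.ofReal d * μ.toSphere (Subtype.val ⁻¹' Metric.closedBall p d) ≤
      μ (Metric.closedBall p (2 * d)) := by
  set A : Set (Metric.sphere (0 : V) 1) := Subtype.val ⁻¹' Metric.closedBall p d
  set B := Metric.closedBall p (2 * d)
  have hA : MeasurableSet A := measurable_subtype_coe Metric.isClosed_closedBall.measurableSet
  have hB : MeasurableSet B := Metric.isClosed_closedBall.measurableSet
  have hmem {r : ℝ} (hr : r ∈ Ioo 1 (1 + d)) {θ : Metric.sphere (0 : V) 1} (hθ : θ ∈ A) :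
      0 + r • (θ : V) ∈ B := by
    have hdist : ‖(θ : V) - p‖ ≤ d := mem_closedBall_iff_norm.1 hθ
    have hsub : 0 + r • (θ : V) - p = (r - 1) • (θ : V) + (θ - p) := by module
    rw [mem_closedBall_iff_norm, hsub]
    refine (norm_add_le _ _).trans ?_
    rw [norm_smul, norm_eq_of_mem_sphere, mul_one, Real.norm_of_nonneg (by linarith [hr.1])]
    linarith [hr.2]
  have hmean {r : ℝ} (hr : r ∈ Ioo 1 (1 + d)) : μ.toSphere A ≤
      ENNReal.ofReal (r ^ (Module.finrank ℝ V - 1)) *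
        ∫⁻ θ, B.indicator 1 (0 + r • (θ : V)) ∂μ.toSphere := by
    rw [← one_mul (μ.toSphere A), ← lintegral_indicator_one hA]
    gcongr with θ
    · exact ENNReal.one_le_ofReal.2 (one_le_pow₀ hr.1.le)
    · exact indicator_le (g := fun θ : Metric.sphere (0 : V) 1 => B.indicator 1 (0 + r • (θ : V)))
        (fun θ hθ => (indicator_of_mem (hmem hr hθ) _).ge) θ
  calc ENNReal.ofReal d * μ.toSphere A
      = ∫⁻ _r in Ioo (1 : ℝ) (1 + d), μ.toSphere A := by
        rw [setLIntegral_const, Real.volume_Ioo, mul_comm, add_sub_cancel_left]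
    _ ≤ ∫⁻ r in Ioo (1 : ℝ) (1 + d), ENNReal.ofReal (r ^ (Module.finrank ℝ V - 1)) *
          ∫⁻ θ, B.indicator 1 (0 + r • (θ : V)) ∂μ.toSphere :=
        setLIntegral_mono' measurableSet_Ioo fun r => hmean
    _ ≤ ∫⁻ r in Ioi (0 : ℝ), ENNReal.ofReal (r ^ (Module.finrank ℝ V - 1)) *
          ∫⁻ θ, B.indicator 1 (0 + r • (θ : V)) ∂μ.toSphere :=
        lintegral_mono_set fun r hr => one_pos.trans hr.1
    _ = μ B := by
        rw [← lintegral_eq_lintegral_toSphere μ (measurable_one.indicator hB) 0,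
          lintegral_indicator_one hB]

theorem toSphere_closedBall_le (p : V) {d : ℝ} (hd : 0 ≤ d) :
    μ.toSphere (Subtype.val ⁻¹' Metric.closedBall p d) ≤
      (2 ^ Module.finrank ℝ V * μ (Metric.closedBall 0 1)) *
        ENNReal.ofReal d ^ (Module.finrank ℝ V - 1) := by
  set c := 2 ^ Module.finrank ℝ V * μ (Metric.closedBall 0 1)
  have hc : c ≠ ∞ :=
    ENNReal.mul_ne_top (by simp) (isCompact_closedBall _ _).measure_lt_top.ne
  have hpos {e : ℝ} (he : 0 < e) : μ.toSphere (Subtype.val ⁻¹' Metric.closedBall p e) ≤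
      c * ENNReal.ofReal e ^ (Module.finrank ℝ V - 1) := by
    have hle := ofReal_mul_toSphere_closedBall_le μ p e
    rw [Measure.addHaar_closedBall' _ _ (by positivity), mul_pow,
      ENNReal.ofReal_mul (by positivity),
      ← Nat.sub_add_cancel (Module.finrank_pos (R := ℝ) (M := V)), pow_succ e,
      ENNReal.ofReal_mul (by positivity), ENNReal.ofReal_pow he.le,
      Nat.sub_add_cancel (Module.finrank_pos (R := ℝ) (M := V)),
      ENNReal.ofReal_pow zero_le_two, ENNReal.ofReal_ofNat] at hle
    refine (ENNReal.mul_le_mul_iff_right (ENNReal.ofReal_pos.2 he).ne' ENNReal.ofReal_ne_top).1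
      (hle.trans_eq ?_)
    ring
  have hlim : Tendsto (fun e : ℝ => c * ENNReal.ofReal e ^ (Module.finrank ℝ V - 1)) (𝓝[>] d)
      (𝓝 (c * ENNReal.ofReal d ^ (Module.finrank ℝ V - 1))) :=
    ((ENNReal.continuous_const_mul hc).comp
      ((ENNReal.continuous_pow _).comp ENNReal.continuous_ofReal)).continuousWithinAt
  refine ge_of_tendsto hlim (eventually_nhdsWithin_of_forall fun e (he : d < e) => ?_)
  exact (measure_mono (preimage_mono (Metric.closedBall_subset_closedBall he.le))).trans
    (hpos (hd.trans_lt he))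

theorem toSphere_le_smul_hausdorffMeasure :
    μ.toSphere ≤ (2 ^ Module.finrank ℝ V * μ (Metric.closedBall 0 1)) •
      Measure.hausdorffMeasure (Module.finrank ℝ V - 1) := by
  set c := 2 ^ Module.finrank ℝ V * μ (Metric.closedBall 0 1)
  have hc : c ≠ ∞ :=
    ENNReal.mul_ne_top (by simp) (isCompact_closedBall _ _).measure_lt_top.ne
  have hc0 : c ≠ 0 :=
    mul_ne_zero (by simp) (Metric.measure_closedBall_pos μ 0 one_pos).ne'
  have hdiam (s : Set (Metric.sphere (0 : V) 1)) (hs : Metric.ediam s ≤ 1) :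
      μ.toSphere s ≤ c * Metric.ediam s ^ (Module.finrank ℝ V - 1 : ℝ) := by
    obtain rfl | ⟨p, hp⟩ := s.eq_empty_or_nonempty
    · simp
    have hfin : Metric.ediam s ≠ ∞ := ne_top_of_le_ne_top ENNReal.one_ne_top hs
    have hsub : s ⊆ Subtype.val ⁻¹' Metric.closedBall (p : V) (Metric.ediam s).toReal :=
      fun θ hθ => Metric.dist_le_diam_of_mem' hfin hθ hp
    calc μ.toSphere s ≤ c * ENNReal.ofReal (Metric.ediam s).toReal ^ (Module.finrank ℝ V - 1) :=
          (measure_mono hsub).trans (toSphere_closedBall_le μ _ ENNReal.toReal_nonneg)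
      _ = c * Metric.ediam s ^ (Module.finrank ℝ V - 1 : ℝ) := by
          rw [ENNReal.ofReal_toReal hfin, ← ENNReal.rpow_natCast, Nat.cast_pred Module.finrank_pos]
  have hle : c⁻¹ • μ.toSphere ≤ Measure.hausdorffMeasure (Module.finrank ℝ V - 1) := by
    refine Measure.le_hausdorffMeasure _ _ 1 one_pos fun s hs => ?_
    rw [Measure.smul_apply, smul_eq_mul, ENNReal.inv_mul_le_iff hc0 hc]
    exact hdiam s hs
  refine Measure.le_iff'.2 fun s => ?_
  have := hle s
  rwa [Measure.smul_apply, smul_eq_mul, ENNReal.inv_mul_le_iff hc0 hc] at this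

theorem lintegral_toSphere_lt_top {y : V} {r : ℝ} (hr : 0 < r)
    (hg : ∫⁻ z in Metric.sphere y r, g z ∂Measure.hausdorffMeasure (Module.finrank ℝ V - 1) < ∞) :
    ∫⁻ θ, g (y + r • (θ : V)) ∂μ.toSphere < ∞ := by
  set φ : Metric.sphere (0 : V) 1 → V := fun θ => y + r • (θ : V)
  have hφ : MeasurableEmbedding φ :=
    (Continuous.isClosedEmbedding (by fun_prop) fun θ θ' h =>
      Subtype.ext (smul_right_injective _ hr.ne' (add_left_cancel h))).measurableEmbedding
  set c := 2 ^ Module.finrank ℝ V * μ (Metric.closedBall 0 1)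
  have hc : c ≠ ∞ :=
    ENNReal.mul_ne_top (by simp) (isCompact_closedBall _ _).measure_lt_top.ne
  have hdim : (0 : ℝ) ≤ Module.finrank ℝ V - 1 :=
    sub_nonneg.2 (Nat.one_le_cast.2 Module.finrank_pos)
  calc ∫⁻ θ, g (φ θ) ∂μ.toSphere
      ≤ ∫⁻ θ, g (φ θ) ∂c • Measure.hausdorffMeasure (Module.finrank ℝ V - 1) :=
        lintegral_mono' (toSphere_le_smul_hausdorffMeasure μ) le_rfl
    _ = c * ∫⁻ z, g z ∂(Measure.hausdorffMeasure (Module.finrank ℝ V - 1)).map φ := by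
        rw [lintegral_smul_measure, hφ.lintegral_map, smul_eq_mul]
    _ ≤ c * (ENNReal.ofReal r⁻¹ ^ (Module.finrank ℝ V - 1 : ℝ) *
          ∫⁻ z in Metric.sphere y r, g z ∂Measure.hausdorffMeasure (Module.finrank ℝ V - 1)) := by
        rw [← smul_eq_mul (_ ^ _), ← lintegral_smul_measure]
        gcongr
        exact map_add_smul_hausdorffMeasure_le y hr hdim
    _ < ∞ := ENNReal.mul_lt_top hc.lt_top (ENNReal.mul_lt_top
        (ENNReal.rpow_lt_top_of_nonneg hdim ENNReal.ofReal_ne_top) hg)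

theorem lintegral_mul_comp_dist (hg : Measurable g) {w : ℝ → ℝ≥0∞} (hw : Measurable w) (x : V) :
    ∫⁻ y, g y * w (dist y x) ∂μ =
      ∫⁻ r in Ioi (0 : ℝ), ENNReal.ofReal (r ^ (Module.finrank ℝ V - 1)) *
        (∫⁻ θ, g (x + r • (θ : V)) ∂μ.toSphere) * w r := by
  have hgw : Measurable fun y => g y * w (dist y x) := hg.mul (hw.comp (by fun_prop))
  rw [lintegral_eq_lintegral_toSphere μ hgw x]
  refine setLIntegral_congr_fun measurableSet_Ioi fun r (hr : 0 < r) => ?_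
  have hdist (θ : Metric.sphere (0 : V) 1) : dist (x + r • (θ : V)) x = r := by
    simp [norm_smul, abs_of_pos hr]
  simp only [hdist]
  rw [lintegral_mul_const _ (measurable_comp_add_smul hg x r), mul_assoc]

theorem ae_lintegral_toSphere_lt_top (hg : AEMeasurable g μ) {y : V} {E : Set ℝ}
    (hE : E ⊆ Ioi 0) (hgE : ∀ r ∈ E,
      ∫⁻ z in Metric.sphere y r, g z ∂Measure.hausdorffMeasure (Module.finrank ℝ V - 1) < ∞) :
    ∀ᵐ r : ℝ, r ∈ E → ∫⁻ θ, hg.mk g (y + r • (θ : V)) ∂μ.toSphere < ∞ := by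
  have hmk := (ae_restrict_iff' measurableSet_Ioi).1 (ae_ae_toSphere_mem μ hg.ae_eq_mk y)
  filter_upwards [hmk] with r hr hrE
  have hr0 : 0 < r := hE hrE
  have hmean := lintegral_toSphere_lt_top μ hr0 (hgE r hrE)
  rwa [lintegral_congr_ae (hr hr0)] at hmean

end Polar

theorem exists_one_le_lintegral_mul_pow_lt_top {α : Type*} [MeasurableSpace α] {μ : Measure α}
    [IsFiniteMeasure μ] {q : α → ℝ≥0∞} (hq : Measurable q) (hpos : μ {x | q x < ∞} ≠ 0)
    {p : ℕ} (hp : p ≠ 0) :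
    ∃ η : α → ℝ≥0∞, Measurable η ∧ 1 ≤ ∫⁻ x, η x ∂μ ∧ ∫⁻ x, q x * η x ^ p ∂μ < ∞ := by
  obtain ⟨N, hN⟩ : ∃ N : ℕ, μ {x | q x ≤ N} ≠ 0 := by
    by_contra! hzero
    refine hpos (measure_mono_null (fun x hx => ?_) (measure_iUnion_null hzero))
    obtain ⟨N, hN⟩ := ENNReal.exists_nat_gt (ne_of_lt hx)
    exact mem_iUnion.2 ⟨N, hN.le⟩
  set T := {x | q x ≤ N}
  have hT : MeasurableSet T := measurableSet_le hq measurable_const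
  refine ⟨T.indicator fun _ => (μ T)⁻¹, measurable_const.indicator hT, ?_, ?_⟩
  · rw [lintegral_indicator_const hT, ENNReal.inv_mul_cancel hN (measure_ne_top _ _)]
  · have hle (x : α) : q x * T.indicator (fun _ => (μ T)⁻¹) x ^ p ≤ N * (μ T)⁻¹ ^ p := by
      by_cases hx : x ∈ T
      · rw [indicator_of_mem hx]
        exact mul_le_mul_left hx _
      · simp [hx, hp]
    refine (lintegral_mono hle).trans_lt ?_
    rw [lintegral_const]
    exact ENNReal.mul_lt_top (ENNReal.mul_lt_top (ENNReal.natCast_lt_top N)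
      (ENNReal.pow_lt_top (ENNReal.inv_lt_top.2 (pos_iff_ne_zero.2 hN)))) (measure_lt_top _ _)

theorem exists_weight_lintegral_ring_lt_top {V : Type*} [NormedAddCommGroup V] [NormedSpace ℝ V]
    [MeasurableSpace V] [BorelSpace V] [FiniteDimensional ℝ V] [Nontrivial V]
    {μ : Measure V} [μ.IsAddHaarMeasure]
    {g : V → ℝ≥0∞} (hg : AEMeasurable g μ) {y : V} {r₁ r₂ : ℝ} (hr₁ : 0 < r₁) {E : Set ℝ}
    (hE : E ⊆ Icc r₁ r₂) (hEpos : volume E ≠ 0) (hgE : ∀ r ∈ E,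
      ∫⁻ z in Metric.sphere y r, g z ∂Measure.hausdorffMeasure (Module.finrank ℝ V - 1) < ∞)
    {p : ℕ} (hp : p ≠ 0) :
    ∃ η : ℝ → ℝ≥0∞, Measurable η ∧ 1 ≤ ∫⁻ r in Ioo r₁ r₂, η r ∧
      ∫⁻ z in {z | dist z y ∈ Ioo r₁ r₂}, g z * η (dist z y) ^ p ∂μ < ∞ := by
  set q : ℝ → ℝ≥0∞ := fun r => ENNReal.ofReal (r ^ (Module.finrank ℝ V - 1)) *
    ∫⁻ θ, hg.mk g (y + r • (θ : V)) ∂μ.toSphere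
  have hq : Measurable q := (by fun_prop : Measurable fun r : ℝ => ENNReal.ofReal (r ^ _)).mul
    (measurable_lintegral_toSphere μ hg.measurable_mk y)
  have hpos : volume.restrict (Ioo r₁ r₂) {r | q r < ∞} ≠ 0 := by
    rw [restrict_Ioo_eq_restrict_Icc, Measure.restrict_apply (measurableSet_lt hq measurable_const)]
    refine fun hzero => hEpos (measure_mono_null_ae ?_ hzero)
    filter_upwards [ae_lintegral_toSphere_lt_top μ hg (fun r hr => hr₁.trans_le (hE hr).1) hgE]
      with r hr hrE
    exact ⟨ENNReal.mul_lt_top ENNReal.ofReal_lt_top (hr hrE), hE hrE⟩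
  obtain ⟨η, hη, hη1, hηfin⟩ := exists_one_le_lintegral_mul_pow_lt_top hq hpos hp
  refine ⟨η, hη, hη1, ?_⟩
  set w := (Ioo r₁ r₂).indicator fun r => η r ^ p
  calc ∫⁻ z in {z | dist z y ∈ Ioo r₁ r₂}, g z * η (dist z y) ^ p ∂μ
      = ∫⁻ z, hg.mk g z * w (dist z y) ∂μ := by
        have hring : MeasurableSet {z | dist z y ∈ Ioo r₁ r₂} :=
          measurableSet_Ioo.preimage (by fun_prop)
        rw [← lintegral_indicator hring]
        refine lintegral_congr_ae (hg.ae_eq_mk.mono fun z hz => ?_)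
        by_cases hzr : dist z y ∈ Ioo r₁ r₂
        · rw [indicator_of_mem (show z ∈ {z | dist z y ∈ Ioo r₁ r₂} from hzr), hz]
          simp only [w, indicator_of_mem hzr]
        · rw [indicator_of_notMem (show z ∉ {z | dist z y ∈ Ioo r₁ r₂} from hzr)]
          simp only [w, indicator_of_notMem hzr, mul_zero]
    _ = ∫⁻ r in Ioi 0, q r * w r :=
        lintegral_mul_comp_dist μ hg.measurable_mk
          ((hη.pow_const p).indicator measurableSet_Ioo) y
    _ ≤ ∫⁻ r in Ioo r₁ r₂, q r * η r ^ p := by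
        rw [← lintegral_indicator measurableSet_Ioo]
        refine (setLIntegral_le_lintegral _ _).trans_eq (lintegral_congr fun r => ?_)
        by_cases hr : r ∈ Ioo r₁ r₂ <;> simp [w, hr]
    _ < ∞ := hηfin

/-! ### Line integrals along Lipschitz paths -/

section LineIntegral

variable {V : Type*} [PseudoEMetricSpace V] {g : ℝ → V} {s : Set ℝ} {L : ℝ≥0}

theorem variationOnFromTo_le_of_lipschitzOnWith (hg : LipschitzOnWith L g s) {u t : ℝ}
    (hu : u ∈ s) (ht : t ∈ s) (hut : u ≤ t) : variationOnFromTo g s u t ≤ L * (t - u) := by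
  rw [variationOnFromTo.eq_of_le _ _ hut]
  refine ENNReal.toReal_le_of_le_ofReal (mul_nonneg L.2 (sub_nonneg.2 hut)) ?_
  have hvar := (hg.mono (inter_subset_left (t := Icc u t))).comp_eVariationOn_le
    (mapsTo_id (s ∩ Icc u t))
  rw [Function.comp_id, (monotoneOn_id (s := s)).eVariationOn_eq hu ht] at hvar
  rwa [ENNReal.ofReal_mul L.coe_nonneg, ENNReal.ofReal_coe_nnreal]

theorem lipschitzOnWith_variationOnFromTo (hg : LipschitzOnWith L g s) {a : ℝ} (ha : a ∈ s) :
    LipschitzOnWith L (variationOnFromTo g s a) s := by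
  have hbv := hg.locallyBoundedVariationOn
  refine LipschitzOnWith.of_le_add_mul L fun t ht u hu => ?_
  rcases le_total u t with h | h
  · rw [Real.dist_eq, abs_of_nonneg (sub_nonneg.2 h), ← variationOnFromTo.add hbv ha hu ht]
    gcongr
    exact variationOnFromTo_le_of_lipschitzOnWith hg hu ht h
  · exact (variationOnFromTo.monotoneOn hbv ha ht hu h).trans
      (le_add_of_nonneg_right (by positivity))

theorem restrict_image_le_smul_map {φ : ℝ → ℝ} (hφ : LipschitzOnWith L φ s)
    (hs : MeasurableSet s) :
    volume.restrict (φ '' s) ≤ (L : ℝ≥0∞) • (volume.restrict s).map φ := by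
  refine Measure.le_iff.2 fun B hB => ?_
  have hlip := (hφ.mono (inter_subset_right (s := φ ⁻¹' B))).hausdorffMeasure_image_le zero_le_one
  rw [hausdorffMeasure_real, ENNReal.rpow_one] at hlip
  rwa [Measure.smul_apply, smul_eq_mul, Measure.map_apply_of_aemeasurable
    (hφ.continuousOn.aemeasurable hs) hB, Measure.restrict_apply hB,
    Measure.restrict_apply₀' hs.nullMeasurableSet, inter_comm B, ← image_inter_preimage,
    inter_comm s]

end LineIntegral

theorem ClosedPath.lineIntegral_le_of_lipschitzOnWith {n : ℕ} (γ : ClosedPath n) {L : ℝ≥0}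
    (hL : LipschitzOnWith L γ.toFun (Icc γ.a γ.b)) (ρ : Rn n → ℝ≥0∞) :
    γ.lineIntegral ρ ≤ L * ∫⁻ t in Icc γ.a γ.b, ρ (γ.toFun t) := by
  set s := Icc γ.a γ.b
  set σ := variationOnFromTo γ.toFun s γ.a
  set γ₀ := naturalParameterization γ.toFun s γ.a
  have ha : γ.a ∈ s := left_mem_Icc.2 γ.lt.le
  have hσ : LipschitzOnWith L σ s := lipschitzOnWith_variationOnFromTo hL ha
  have hσa : σ γ.a = 0 := variationOnFromTo.self _ _ _
  have hσb : σ γ.b = γ.length.toReal := by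
    simp only [σ, variationOnFromTo.eq_of_le _ _ γ.lt.le, s, inter_self]
    rfl
  have hsurj : Icc 0 γ.length.toReal ⊆ σ '' s := by
    rw [← hσa, ← hσb]
    exact intermediate_value_Icc γ.lt.le hσ.continuousOn
  calc γ.lineIntegral ρ ≤ ∫⁻ x in σ '' s, ρ (γ₀ x) := lintegral_mono_set hsurj
    _ ≤ L * ∫⁻ x, ρ (γ₀ x) ∂((volume.restrict s).map σ) := by
      rw [← smul_eq_mul, ← lintegral_smul_measure]
      exact lintegral_mono' (restrict_image_le_smul_map hσ measurableSet_Icc) le_rfl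
    _ ≤ L * ∫⁻ t in s, ρ (γ₀ (σ t)) := mul_le_mul_right (lintegral_map_le (fun x => ρ (γ₀ x)) σ) _
    _ = L * ∫⁻ t in s, ρ (γ.toFun t) := by
      congr 1
      refine setLIntegral_congr_fun measurableSet_Icc fun t ht => ?_
      simp only [γ₀, σ, edist_eq_zero.1
        (edist_naturalParameterization_eq_zero hL.locallyBoundedVariationOn ha ht)]

/-! ### Broken lines on the sphere -/

section BrokenLine

variable {V : Type*} [NormedAddCommGroup V] [NormedSpace ℝ V]

theorem norm_mul_norm_normalize_sub_le (x y : V) :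
    ‖x‖ * ‖normalize x - normalize y‖ ≤ 2 * ‖x - y‖ := by
  have hdecomp : ‖x‖ • (normalize x - normalize y) = (x - y) + (‖y‖ - ‖x‖) • normalize y := by
    rw [smul_sub, sub_smul, norm_smul_normalize, norm_smul_normalize]
    abel
  have hle : ‖normalize y‖ ≤ 1 := by
    rw [NormedSpace.normalize, norm_smul, norm_inv, norm_norm]
    exact inv_mul_le_one
  calc ‖x‖ * ‖normalize x - normalize y‖ = ‖(x - y) + (‖y‖ - ‖x‖) • normalize y‖ := by
        rw [← hdecomp, norm_smul, norm_norm]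
    _ ≤ ‖x - y‖ + |‖y‖ - ‖x‖| * ‖normalize y‖ := by
        rw [← Real.norm_eq_abs, ← norm_smul]
        exact norm_add_le _ _
    _ ≤ ‖x - y‖ + ‖x - y‖ * 1 := by
        rw [norm_sub_rev x y]
        gcongr
        exact abs_norm_sub_norm_le y x
    _ = 2 * ‖x - y‖ := by ring

/-- The broken line from `c` through `z` to `k`, parametrized by `[0, 2]`. -/
def brokenLine (c z k : V) (t : ℝ) : V := c + min t 1 • (z - c) + max (t - 1) 0 • (k - z)

theorem brokenLine_of_le (c z k : V) {t : ℝ} (ht : t ≤ 1) :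
    brokenLine c z k t = (1 - t) • c + t • z := by
  rw [brokenLine, min_eq_left ht, max_eq_right (by linarith)]
  module

theorem brokenLine_of_ge (c z k : V) {t : ℝ} (ht : 1 ≤ t) :
    brokenLine c z k t = (1 - (2 - t)) • k + (2 - t) • z := by
  rw [brokenLine, min_eq_right ht, max_eq_left (by linarith)]
  module

theorem brokenLine_zero (c z k : V) : brokenLine c z k 0 = c := by
  rw [brokenLine_of_le _ _ _ zero_le_one]
  module

theorem brokenLine_two (c z k : V) : brokenLine c z k 2 = k := by
  rw [brokenLine_of_ge _ _ _ one_le_two]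
  module

theorem norm_brokenLine_sub_le (c z k : V) (s t : ℝ) :
    ‖brokenLine c z k s - brokenLine c z k t‖ ≤ (‖z - c‖ + ‖k - z‖) * |s - t| := by
  have hdecomp : brokenLine c z k s - brokenLine c z k t =
      (min s 1 - min t 1) • (z - c) + (max (s - 1) 0 - max (t - 1) 0) • (k - z) := by
    simp only [brokenLine]
    module
  have hmin : |min s 1 - min t 1| ≤ |s - t| := by
    simpa using abs_min_sub_min_le_max s 1 t 1
  have hmax : |max (s - 1) 0 - max (t - 1) 0| ≤ |s - t| := by
    simpa using abs_max_sub_max_le_max (s - 1) 0 (t - 1) 0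
  calc ‖brokenLine c z k s - brokenLine c z k t‖
      ≤ |min s 1 - min t 1| * ‖z - c‖ + |max (s - 1) 0 - max (t - 1) 0| * ‖k - z‖ := by
        rw [hdecomp, ← Real.norm_eq_abs, ← Real.norm_eq_abs, ← norm_smul, ← norm_smul]
        exact norm_add_le _ _
    _ ≤ |s - t| * ‖z - c‖ + |s - t| * ‖k - z‖ := by gcongr
    _ = (‖z - c‖ + ‖k - z‖) * |s - t| := by ring

theorem lintegral_brokenLine_le (g : V → ℝ≥0∞) (c z k : V) :
    ∫⁻ t in Icc (0 : ℝ) 2, g (brokenLine c z k t) ≤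
      (∫⁻ t in Ioo (0 : ℝ) 1, g ((1 - t) • c + t • z)) +
        ∫⁻ t in Ioo (0 : ℝ) 1, g ((1 - t) • k + t • z) := by
  have hfirst : ∫⁻ t in Icc (0 : ℝ) 1, g (brokenLine c z k t) =
      ∫⁻ t in Ioo (0 : ℝ) 1, g ((1 - t) • c + t • z) := by
    rw [← restrict_Ioo_eq_restrict_Icc]
    exact setLIntegral_congr_fun measurableSet_Ioo fun t ht => by
      simp only [brokenLine_of_le c z k ht.2.le]
  have hsecond : ∫⁻ t in Icc (1 : ℝ) 2, g (brokenLine c z k t) =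
      ∫⁻ t in Ioo (0 : ℝ) 1, g ((1 - t) • k + t • z) := by
    have hreflect :=
      (Measure.measurePreserving_sub_left volume (2 : ℝ)).setLIntegral_comp_preimage_emb
        (MeasurableEquiv.subLeft (2 : ℝ)).measurableEmbedding (fun t => g ((1 - t) • k + t • z))
        (Ioo 0 1)
    rw [← restrict_Ioo_eq_restrict_Icc, ← hreflect, preimage_const_sub_Ioo]
    norm_num only
    exact setLIntegral_congr_fun measurableSet_Ioo fun t ht => by
      simp only [brokenLine_of_ge c z k ht.1.le]
  rw [← hfirst, ← hsecond, ← Icc_union_Icc_eq_Icc zero_le_one one_le_two]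
  exact lintegral_union_le _ _ _

end BrokenLine

section BrokenArc

variable {V : Type*} [NormedAddCommGroup V] [InnerProductSpace ℝ V] {c k u z : V}

theorem two_fifths_le_norm_segment (hc : ‖c‖ = 1) (hu : ‖u‖ = 1) (hcu : 0 ≤ inner ℝ c u)
    (hz : z ∈ Metric.ball u 4⁻¹) {t : ℝ} (ht : t ∈ Icc (0 : ℝ) 1) :
    2 / 5 ≤ ‖(1 - t) • c + t • z‖ := by
  obtain ⟨ht0, ht1⟩ := ht
  rw [mem_ball_iff_norm] at hz
  have hcross : 0 ≤ (1 - t) * (t * inner ℝ c u) :=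
    mul_nonneg (sub_nonneg.2 ht1) (mul_nonneg ht0 hcu)
  have hcenter : (7 / 10 : ℝ) ≤ ‖(1 - t) • c + t • u‖ := by
    refine le_of_sq_le_sq ?_ (norm_nonneg _)
    rw [norm_add_sq_real, norm_smul, norm_smul, hc, hu, real_inner_smul_left,
      real_inner_smul_right, Real.norm_of_nonneg (sub_nonneg.2 ht1), Real.norm_of_nonneg ht0]
    nlinarith [sq_nonneg (2 * t - 1)]
  have hdist : ‖t • (z - u)‖ ≤ 1 / 4 := by
    rw [norm_smul, Real.norm_of_nonneg ht0]
    nlinarith [norm_nonneg (z - u)]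
  have hsplit : (1 - t) • c + t • u = ((1 - t) • c + t • z) - t • (z - u) := by module
  have htri := norm_sub_le ((1 - t) • c + t • z) (t • (z - u))
  rw [← hsplit] at htri
  linarith

theorem two_fifths_le_norm_brokenLine (hc : ‖c‖ = 1) (hk : ‖k‖ = 1) (hu : ‖u‖ = 1)
    (hcu : 0 ≤ inner ℝ c u) (hku : 0 ≤ inner ℝ k u) (hz : z ∈ Metric.ball u 4⁻¹) {t : ℝ}
    (ht : t ∈ Icc (0 : ℝ) 2) : 2 / 5 ≤ ‖brokenLine c z k t‖ := by
  rcases le_total t 1 with h | h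
  · rw [brokenLine_of_le c z k h]
    exact two_fifths_le_norm_segment hc hu hcu hz ⟨ht.1, h⟩
  · rw [brokenLine_of_ge c z k h]
    exact two_fifths_le_norm_segment hk hu hku hz ⟨by linarith [ht.2], by linarith⟩

theorem lipschitzOnWith_normalize_brokenLine (hc : ‖c‖ = 1) (hk : ‖k‖ = 1) (hu : ‖u‖ = 1)
    (hcu : 0 ≤ inner ℝ c u) (hku : 0 ≤ inner ℝ k u) (hz : z ∈ Metric.ball u 4⁻¹) :
    LipschitzOnWith 30 (fun t => normalize (brokenLine c z k t)) (Icc 0 2) := by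
  have hzn : ‖z‖ ≤ 5 / 4 := by
    have := norm_le_of_mem_closedBall (Metric.ball_subset_closedBall hz)
    linarith
  refine LipschitzOnWith.of_dist_le_mul fun s hs t _ => ?_
  rw [dist_eq_norm, Real.dist_eq]
  have hs0 := two_fifths_le_norm_brokenLine hc hk hu hcu hku hz hs
  have hnormalize := norm_mul_norm_normalize_sub_le (brokenLine c z k s) (brokenLine c z k t)
  have hline := norm_brokenLine_sub_le c z k s t
  have hlength : (‖z - c‖ + ‖k - z‖) * |s - t| ≤ 6 * |s - t| := by
    gcongr
    linarith [norm_sub_le z c, norm_sub_le k z]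
  have hscale := mul_le_mul_of_nonneg_right hs0
    (norm_nonneg (normalize (brokenLine c z k s) - normalize (brokenLine c z k t)))
  norm_num only [NNReal.coe_ofNat]
  linarith

end BrokenArc

theorem exists_norm_eq_one_inner_nonneg {V : Type*} [NormedAddCommGroup V]
    [InnerProductSpace ℝ V] [FiniteDimensional ℝ V] (hV : 2 ≤ Module.finrank ℝ V) (c k : V) :
    ∃ u : V, ‖u‖ = 1 ∧ 0 ≤ inner ℝ c u ∧ 0 ≤ inner ℝ k u := by
  obtain ⟨v, hv, hv1⟩ : ∃ v : V, inner ℝ c v = 0 ∧ ‖v‖ = 1 := by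
    have hspan : Module.finrank ℝ (Submodule.span ℝ {c}) ≤ 1 := by
      simpa using finrank_span_le_card (R := ℝ) ({c} : Set V)
    have hsum := (Submodule.span ℝ {c}).finrank_add_finrank_orthogonal
    have : Nontrivial (Submodule.span ℝ {c})ᗮ := Module.nontrivial_of_finrank_pos (R := ℝ) (by lia)
    obtain ⟨v, hv⟩ := exists_norm_eq (Submodule.span ℝ {c})ᗮ zero_le_one
    exact ⟨v, Submodule.mem_orthogonal_singleton_iff_inner_right.1 v.2, hv⟩
  rcases le_total 0 (inner ℝ k v) with h | h
  · exact ⟨v, hv1, hv.ge, h⟩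
  · exact ⟨-v, by rwa [norm_neg], by rw [inner_neg_right, hv, neg_zero],
      by rw [inner_neg_right]; exact neg_nonneg.2 h⟩

/-! ### Averaging over segments -/

theorem mem_Ioo_of_smul_mem_ball {V : Type*} [NormedAddCommGroup V] [NormedSpace ℝ V]
    {θ : Metric.sphere (0 : V) 1} {q : V} {r s : ℝ} (hr : 0 < r) (h : r • θ.1 ∈ Metric.ball q s) :
    r ∈ Ioo (‖q‖ - s) (‖q‖ + s) := by
  rw [mem_ball_iff_norm] at h
  have hdist := (abs_norm_sub_norm_le (r • θ.1) q).trans_lt h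
  rw [norm_smul, norm_eq_of_mem_sphere, Real.norm_of_nonneg hr.le, mul_one, abs_lt] at hdist
  exact ⟨by linarith [hdist.1], by linarith [hdist.2]⟩

section Normed

variable {V : Type*} [NormedAddCommGroup V] [NormedSpace ℝ V] [MeasurableSpace V] [BorelSpace V]
  [FiniteDimensional ℝ V]

theorem measurable_normalize : Measurable fun w : V => normalize w := by
  unfold NormedSpace.normalize
  fun_prop

variable (μ : Measure V) [μ.IsAddHaarMeasure] {h : V → ℝ≥0∞}

theorem lintegral_comp_add_smul (hh : Measurable h) (c : V) {t : ℝ} (ht : 0 < t) :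
    ∫⁻ z, h (c + t • z) ∂μ = ENNReal.ofReal (t ^ Module.finrank ℝ V)⁻¹ * ∫⁻ w, h w ∂μ := by
  have hm : Measurable fun z : V => t • z := by fun_prop
  rw [← lintegral_map (f := fun w => h (c + w)) (hh.comp (by fun_prop)) hm,
    Measure.map_addHaar_smul _ ht.ne', lintegral_smul_measure, lintegral_add_left_eq_self h c,
    abs_of_pos (by positivity), smul_eq_mul]

variable [Nontrivial V]

theorem setLIntegral_ball_comp_normalize_le (hh : Measurable h) {q : V} (hq : ‖q‖ ≤ 1) {s : ℝ}
    (hs : s ≤ 1) :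
    ∫⁻ w in Metric.ball q s, h (normalize w) ∂μ ≤
      ENNReal.ofReal (2 ^ Module.finrank ℝ V * s) * ∫⁻ θ, h θ.1 ∂μ.toSphere := by
  have hball : MeasurableSet (Metric.ball q s) := Metric.isOpen_ball.measurableSet
  set d := Module.finrank ℝ V
  set H := ∫⁻ θ, h θ.1 ∂μ.toSphere
  set I := Ioo (‖q‖ - s) (‖q‖ + s)
  set F := (Metric.ball q s).indicator fun w => h (normalize w)
  have hF : Measurable F := (hh.comp measurable_normalize).indicator hball
  have hslice {r : ℝ} (hr : 0 < r) : ENNReal.ofReal (r ^ (d - 1)) *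
      ∫⁻ θ, F (0 + r • θ.1) ∂μ.toSphere ≤
        I.indicator (fun _ => ENNReal.ofReal (2 ^ (d - 1)) * H) r := by
    by_cases hrI : r ∈ I
    · rw [indicator_of_mem hrI]
      refine mul_le_mul' (ENNReal.ofReal_le_ofReal
        (pow_le_pow_left₀ hr.le (by linarith [hrI.2]) _)) (lintegral_mono fun θ => ?_)
      refine (indicator_le_self _ _ _).trans_eq ?_
      rw [zero_add, normalize_smul_of_pos hr,
        normalize_eq_self_of_norm_eq_one (norm_eq_of_mem_sphere θ)]
    · have hzero (θ : Metric.sphere (0 : V) 1) : F (0 + r • θ.1) = 0 := by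
        rw [zero_add]
        exact indicator_of_notMem (fun hθ => hrI (mem_Ioo_of_smul_mem_ball hr hθ)) _
      rw [lintegral_congr hzero, lintegral_zero, mul_zero]
      exact zero_le
  calc ∫⁻ w in Metric.ball q s, h (normalize w) ∂μ
      = ∫⁻ r in Ioi (0 : ℝ), ENNReal.ofReal (r ^ (d - 1)) *
          ∫⁻ θ, F (0 + r • θ.1) ∂μ.toSphere := by
        rw [← lintegral_indicator hball, lintegral_eq_lintegral_toSphere μ hF 0]
    _ ≤ ∫⁻ r in Ioi 0, I.indicator (fun _ => ENNReal.ofReal (2 ^ (d - 1)) * H) r :=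
        setLIntegral_mono' measurableSet_Ioi fun r hr => hslice hr
    _ ≤ ENNReal.ofReal (2 ^ (d - 1)) * H * volume I := by
        rw [← lintegral_indicator_const measurableSet_Ioo]
        exact setLIntegral_le_lintegral _ _
    _ = ENNReal.ofReal (2 ^ d * s) * H := by
        rw [Real.volume_Ioo, mul_right_comm, ← ENNReal.ofReal_mul (by positivity)]
        congr 2
        rw [← pow_sub_one_mul Module.finrank_pos.ne' (2 : ℝ)]
        ring

theorem setLIntegral_ball_comp_normalize_segment_le (hh : Measurable h) {c u : V} (hc : ‖c‖ = 1)
    (hu : ‖u‖ = 1) {t : ℝ} (ht : t ∈ Ioo (0 : ℝ) 1) :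
    ∫⁻ z in Metric.ball u 4⁻¹, h (normalize ((1 - t) • c + t • z)) ∂μ ≤
      ENNReal.ofReal (2 ^ Module.finrank ℝ V * (t ^ (Module.finrank ℝ V - 1))⁻¹) *
        ∫⁻ θ, h θ.1 ∂μ.toSphere := by
  obtain ⟨ht0, ht1⟩ := ht
  set q := (1 - t) • c + t • u
  have hq : ‖q‖ ≤ 1 := by
    refine (norm_add_le _ _).trans ?_
    rw [norm_smul, norm_smul, hc, hu, Real.norm_of_nonneg (by linarith), Real.norm_of_nonneg ht0.le]
    linarith
  have hball : MeasurableSet (Metric.ball q t) := Metric.isOpen_ball.measurableSet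
  set F := (Metric.ball q t).indicator fun w => h (normalize w)
  have hF : Measurable F := (hh.comp measurable_normalize).indicator hball
  have hmem {z : V} (hz : z ∈ Metric.ball u 4⁻¹) :
      (1 - t) • c + t • z ∈ Metric.ball q t := by
    rw [Metric.mem_ball] at hz
    rw [Metric.mem_ball, dist_add_left, dist_smul₀, Real.norm_of_nonneg ht0.le]
    nlinarith
  calc ∫⁻ z in Metric.ball u 4⁻¹, h (normalize ((1 - t) • c + t • z)) ∂μ
      ≤ ∫⁻ z in Metric.ball u 4⁻¹, F ((1 - t) • c + t • z) ∂μ :=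
        setLIntegral_mono' Metric.isOpen_ball.measurableSet fun z hz => by
          simp only [F, indicator_of_mem (hmem hz), le_refl]
    _ ≤ ∫⁻ z, F ((1 - t) • c + t • z) ∂μ := setLIntegral_le_lintegral _ _
    _ = ENNReal.ofReal (t ^ Module.finrank ℝ V)⁻¹ *
          ∫⁻ w in Metric.ball q t, h (normalize w) ∂μ := by
        rw [lintegral_comp_add_smul μ hF _ ht0, lintegral_indicator hball]
    _ ≤ ENNReal.ofReal (t ^ Module.finrank ℝ V)⁻¹ *
          (ENNReal.ofReal (2 ^ Module.finrank ℝ V * t) * ∫⁻ θ, h θ.1 ∂μ.toSphere) := by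
        gcongr
        exact setLIntegral_ball_comp_normalize_le μ hh hq ht1.le
    _ = _ := by
        rw [← mul_assoc, ← ENNReal.ofReal_mul (by positivity)]
        congr 2
        rw [← pow_sub_one_mul (Module.finrank_pos (R := ℝ) (M := V)).ne' t]
        field_simp

theorem setLIntegral_ball_normalize_segment_le_rpow {g : V → ℝ≥0∞} (hg : Measurable g) {c u : V}
    (hc : ‖c‖ = 1) (hu : ‖u‖ = 1) {d : ℝ} (hd : d = Module.finrank ℝ V) {t : ℝ}
    (ht : t ∈ Ioo (0 : ℝ) 1) :
    ∫⁻ z in Metric.ball u 4⁻¹, g (normalize ((1 - t) • c + t • z)) ∂μ ≤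
      ENNReal.ofReal (t ^ (d⁻¹ - 1)) * (2 * (∫⁻ θ, g θ.1 ^ d ∂μ.toSphere) ^ d⁻¹ *
        μ (Metric.ball 0 4⁻¹) ^ (1 - d⁻¹)) := by
  have ht0 : 0 < t := ht.1
  have hd1 : 1 ≤ d := by
    rw [hd, Nat.one_le_cast]
    exact Module.finrank_pos
  set ψ : V → ℝ≥0∞ := fun z => g (normalize ((1 - t) • c + t • z))
  have hψ : Measurable ψ := hg.comp (measurable_normalize.comp (by fun_prop))
  have hholder := eLpNorm'_le_eLpNorm'_mul_rpow_measure_univ zero_lt_one hd1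
    hψ.aestronglyMeasurable (μ := μ.restrict (Metric.ball u 4⁻¹))
  simp only [eLpNorm', enorm_eq_self, ENNReal.rpow_one, div_one, one_div,
    Measure.restrict_apply_univ, Measure.addHaar_ball_center] at hholder
  have hscale : (2 ^ Module.finrank ℝ V * (t ^ (Module.finrank ℝ V - 1))⁻¹) ^ d⁻¹ =
      t ^ (d⁻¹ - 1) * 2 := by
    rw [Real.mul_rpow (by positivity) (by positivity), ← Real.rpow_natCast, ← hd,
      Real.rpow_rpow_inv zero_le_two (by positivity), mul_comm, ← Real.rpow_natCast,
      Nat.cast_pred Module.finrank_pos, ← hd, ← Real.rpow_neg ht0.le, ← Real.rpow_mul ht0.le]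
    congr 2
    field_simp
    ring
  calc ∫⁻ z in Metric.ball u 4⁻¹, ψ z ∂μ
      ≤ (∫⁻ z in Metric.ball u 4⁻¹, ψ z ^ d ∂μ) ^ d⁻¹ *
          μ (Metric.ball 0 4⁻¹) ^ (1 - d⁻¹) := hholder
    _ ≤ (ENNReal.ofReal (2 ^ Module.finrank ℝ V * (t ^ (Module.finrank ℝ V - 1))⁻¹) *
          ∫⁻ θ, g θ.1 ^ d ∂μ.toSphere) ^ d⁻¹ * μ (Metric.ball 0 4⁻¹) ^ (1 - d⁻¹) := by
        gcongr
        exact setLIntegral_ball_comp_normalize_segment_le μ (hg.pow_const d) hc hu ht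
    _ = _ := by
        rw [ENNReal.mul_rpow_of_nonneg _ _ (by positivity),
          ENNReal.ofReal_rpow_of_nonneg (by positivity) (by positivity), hscale,
          ENNReal.ofReal_mul (by positivity), ENNReal.ofReal_ofNat]
        ring

end Normed

theorem lintegral_Ioo_rpow {p : ℝ} (hp : -1 < p) :
    ∫⁻ t in Ioo (0 : ℝ) 1, ENNReal.ofReal (t ^ p) = ENNReal.ofReal (p + 1)⁻¹ := by
  have hint := intervalIntegral.intervalIntegrable_rpow' (a := 0) (b := 1) hp
  rw [intervalIntegrable_iff_integrableOn_Ioo_of_le zero_le_one] at hint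
  rw [← ofReal_integral_eq_lintegral_ofReal hint, ← integral_Ioc_eq_integral_Ioo,
    ← intervalIntegral.integral_of_le zero_le_one, integral_rpow (.inl hp), Real.one_rpow,
    Real.zero_rpow (by linarith), sub_zero, one_div]
  filter_upwards [ae_restrict_mem measurableSet_Ioo] with t ht
  exact Real.rpow_nonneg ht.1.le p

theorem lintegral_Ioo_inv {a b : ℝ} (ha : 0 < a) (hab : a ≤ b) :
    ∫⁻ r in Ioo a b, ENNReal.ofReal r⁻¹ = ENNReal.ofReal (Real.log (b / a)) := by
  have hint : IntervalIntegrable (fun r : ℝ => r⁻¹) volume a b := by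
    refine intervalIntegral.intervalIntegrable_inv (fun r hr => ?_) continuousOn_id
    rw [uIcc_of_le hab] at hr
    exact (ha.trans_le hr.1).ne'
  rw [intervalIntegrable_iff_integrableOn_Ioo_of_le hab] at hint
  rw [← ofReal_integral_eq_lintegral_ofReal hint, ← integral_Ioc_eq_integral_Ioo,
    ← intervalIntegral.integral_of_le hab, integral_inv_of_pos ha (ha.trans_le hab)]
  filter_upwards [ae_restrict_mem measurableSet_Ioo] with r hr
  exact inv_nonneg.2 (ha.trans hr.1).le

/-! ### Conformal energy on spheres -/

/-- `ρ` separates `c` from `k`: every Lipschitz path from `c` to `k` has `ρ`-length at least one.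
The `ρ`-length enters through its upper bound by the Lipschitz constant of the path times the
integral of `ρ` over the parameter interval. -/
def SeparatesPoints {V : Type*} [PseudoEMetricSpace V] (ρ : V → ℝ≥0∞) (c k : V) : Prop :=
  ∀ (γ : ℝ → V) (L : ℝ≥0) (a b : ℝ), a ≤ b → LipschitzOnWith L γ (Icc a b) → γ a = c → γ b = k →
    1 ≤ L * ∫⁻ t in Icc a b, ρ (γ t)

/-- A lower bound for the conformal energy `∫ ρ^d` over the unit sphere of a `d`-dimensional space,
when `ρ` separates two points of that sphere. The constants `4⁻¹` and `120` come from averaging over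
broken lines through a ball of radius `4⁻¹`. -/
noncomputable def sphereEnergyBound {V : Type*} [NormedAddCommGroup V] [NormedSpace ℝ V]
    [MeasurableSpace V] (μ : Measure V) : ℝ≥0∞ :=
  μ (Metric.ball 0 4⁻¹) / (120 * Module.finrank ℝ V) ^ Module.finrank ℝ V

theorem div_pow_le_of_le_mul_rpow {v G K : ℝ≥0∞} (hv0 : v ≠ 0) (hv : v ≠ ∞) {d : ℕ} (hd : d ≠ 0)
    (h : v ≤ K * (G ^ (d : ℝ)⁻¹ * v ^ (1 - (d : ℝ)⁻¹))) : v / K ^ d ≤ G := by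
  refine ENNReal.div_le_of_le_mul' ?_
  have hroot : v ^ (d : ℝ)⁻¹ ≤ K * G ^ (d : ℝ)⁻¹ := by
    rw [← mul_assoc] at h
    nth_rw 1 [← ENNReal.rpow_one v, ← add_sub_cancel (d : ℝ)⁻¹ 1, ENNReal.rpow_add _ _ hv0 hv] at h
    exact (ENNReal.mul_le_mul_iff_left (by simp [hv0, hv])
      (ENNReal.rpow_ne_top_of_ne_zero hv0 hv)).1 h
  calc v = (v ^ (d : ℝ)⁻¹) ^ d := by
        rw [← ENNReal.rpow_natCast, ENNReal.rpow_inv_rpow (by positivity)]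
    _ ≤ (K * G ^ (d : ℝ)⁻¹) ^ d := by gcongr
    _ = K ^ d * G := by
        rw [mul_pow, ← ENNReal.rpow_natCast (G ^ _), ENNReal.rpow_inv_rpow (by positivity)]

theorem sphereEnergyBound_ne_zero {V : Type*} [NormedAddCommGroup V] [NormedSpace ℝ V]
    [MeasurableSpace V] (μ : Measure V) [μ.IsOpenPosMeasure] : sphereEnergyBound μ ≠ 0 :=
  (ENNReal.div_pos (Metric.measure_ball_pos _ _ (by positivity)).ne'
    (ENNReal.pow_ne_top (ENNReal.mul_ne_top (by simp) (ENNReal.natCast_ne_top _)))).ne'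

section SphereEnergy

variable {V : Type*} [NormedAddCommGroup V] [InnerProductSpace ℝ V]

theorem SeparatesPoints.one_le_lintegral_normalize {ρ : V → ℝ≥0∞} {x₀ : V} {r : ℝ} (hr : 0 < r)
    {c k u z : V} (hc : ‖c‖ = 1) (hk : ‖k‖ = 1) (hu : ‖u‖ = 1) (hcu : 0 ≤ inner ℝ c u)
    (hku : 0 ≤ inner ℝ k u) (hz : z ∈ Metric.ball u 4⁻¹)
    (h : SeparatesPoints ρ (x₀ + r • c) (x₀ + r • k)) :
    1 ≤ 30 * ((∫⁻ t in Ioo (0 : ℝ) 1,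
        ENNReal.ofReal r * ρ (x₀ + r • normalize ((1 - t) • c + t • z))) +
      ∫⁻ t in Ioo (0 : ℝ) 1,
        ENNReal.ofReal r * ρ (x₀ + r • normalize ((1 - t) • k + t • z))) := by
  have hscale : LipschitzWith (Real.toNNReal r) fun w : V => x₀ + r • w :=
    LipschitzWith.of_dist_le_mul fun w w' => by
      rw [dist_add_left, dist_smul₀, Real.norm_of_nonneg hr.le, Real.coe_toNNReal _ hr.le]
  have hpath := h _ _ 0 2 zero_le_two (hscale.comp_lipschitzOnWith
      (lipschitzOnWith_normalize_brokenLine hc hk hu hcu hku hz))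
    (by rw [Function.comp_apply, brokenLine_zero, normalize_eq_self_of_norm_eq_one hc])
    (by rw [Function.comp_apply, brokenLine_two, normalize_eq_self_of_norm_eq_one hk])
  refine hpath.trans ?_
  rw [ENNReal.coe_mul, mul_comm (Real.toNNReal r : ℝ≥0∞), mul_assoc,
    ← lintegral_const_mul' _ _ ENNReal.coe_ne_top]
  exact mul_le_mul_right (lintegral_brokenLine_le
    (fun w => ENNReal.ofReal r * ρ (x₀ + r • NormedSpace.normalize w)) c z k) _

variable [FiniteDimensional ℝ V] [MeasurableSpace V] [BorelSpace V] (μ : Measure V)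
  [μ.IsAddHaarMeasure]

section Segments

variable [Nontrivial V] {g : V → ℝ≥0∞} (hg : Measurable g)
include hg

theorem lintegral_normalize_segments_le {c u : V} (hc : ‖c‖ = 1) (hu : ‖u‖ = 1) {d : ℝ}
    (hd : d = Module.finrank ℝ V) :
    ∫⁻ z in Metric.ball u 4⁻¹, (∫⁻ t in Ioo (0 : ℝ) 1, g (normalize ((1 - t) • c + t • z))) ∂μ ≤
      ENNReal.ofReal d * (2 * (∫⁻ θ, g θ.1 ^ d ∂μ.toSphere) ^ d⁻¹ *
        μ (Metric.ball 0 4⁻¹) ^ (1 - d⁻¹)) := by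
  have hd0 : 0 < d := by
    rw [hd, Nat.cast_pos]
    exact Module.finrank_pos
  have hm : Measurable fun p : V × ℝ => g (normalize ((1 - p.2) • c + p.2 • p.1)) :=
    hg.comp (measurable_normalize.comp (by fun_prop))
  have hint := lintegral_Ioo_rpow (p := d⁻¹ - 1) (by linarith [inv_pos.2 hd0])
  rw [sub_add_cancel, inv_inv] at hint
  rw [lintegral_lintegral_swap hm.aemeasurable, ← hint, ← lintegral_mul_const _ (by fun_prop)]
  exact setLIntegral_mono' measurableSet_Ioo fun t ht =>
    setLIntegral_ball_normalize_segment_le_rpow μ hg hc hu hd ht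

theorem measure_ball_le_of_one_le_lintegral_segments {c k u : V} (hc : ‖c‖ = 1) (hk : ‖k‖ = 1)
    (hu : ‖u‖ = 1) {d : ℝ} (hd : d = Module.finrank ℝ V)
    (h : ∀ z ∈ Metric.ball u 4⁻¹, 1 ≤ 30 *
      ((∫⁻ t in Ioo (0 : ℝ) 1, g (normalize ((1 - t) • c + t • z))) +
        ∫⁻ t in Ioo (0 : ℝ) 1, g (normalize ((1 - t) • k + t • z)))) :
    μ (Metric.ball 0 4⁻¹) ≤ 120 * ENNReal.ofReal d *
      ((∫⁻ θ, g θ.1 ^ d ∂μ.toSphere) ^ d⁻¹ * μ (Metric.ball 0 4⁻¹) ^ (1 - d⁻¹)) := by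
  have hm (p : V) : Measurable fun z : V =>
      ∫⁻ t in Ioo (0 : ℝ) 1, g (normalize ((1 - t) • p + t • z)) := by
    have : Measurable fun q : V × ℝ => g (normalize ((1 - q.2) • p + q.2 • q.1)) :=
      hg.comp (measurable_normalize.comp (by fun_prop))
    exact this.lintegral_prod_right'
  calc μ (Metric.ball 0 4⁻¹) = ∫⁻ _z in Metric.ball u 4⁻¹, 1 ∂μ := by
        rw [setLIntegral_one, Measure.addHaar_ball_center μ u]
    _ ≤ ∫⁻ z in Metric.ball u 4⁻¹, 30 *
        ((∫⁻ t in Ioo (0 : ℝ) 1, g (normalize ((1 - t) • c + t • z))) +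
          ∫⁻ t in Ioo (0 : ℝ) 1, g (normalize ((1 - t) • k + t • z))) ∂μ :=
        setLIntegral_mono' Metric.isOpen_ball.measurableSet h
    _ = 30 * ((∫⁻ z in Metric.ball u 4⁻¹,
          (∫⁻ t in Ioo (0 : ℝ) 1, g (normalize ((1 - t) • c + t • z))) ∂μ) +
        ∫⁻ z in Metric.ball u 4⁻¹,
          (∫⁻ t in Ioo (0 : ℝ) 1, g (normalize ((1 - t) • k + t • z))) ∂μ) := by
        rw [lintegral_const_mul' _ _ (by simp), lintegral_add_left (hm c)]
    _ ≤ 30 * (2 * (ENNReal.ofReal d * (2 * (∫⁻ θ, g θ.1 ^ d ∂μ.toSphere) ^ d⁻¹ *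
          μ (Metric.ball 0 4⁻¹) ^ (1 - d⁻¹)))) := by
        rw [two_mul (ENNReal.ofReal d * _)]
        gcongr
        · exact lintegral_normalize_segments_le μ hg hc hu hd
        · exact lintegral_normalize_segments_le μ hg hk hu hd
    _ = _ := by ring

end Segments

variable {ρ : V → ℝ≥0∞}

theorem sphereEnergyBound_le (hV : 2 ≤ Module.finrank ℝ V) (hρ : Measurable ρ) {x₀ : V} {r : ℝ}
    (hr : 0 < r) {c k : V} (hc : c ∈ Metric.sphere x₀ r) (hk : k ∈ Metric.sphere x₀ r)
    (h : SeparatesPoints ρ c k) :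
    sphereEnergyBound μ ≤ ENNReal.ofReal r ^ Module.finrank ℝ V *
      ∫⁻ θ, ρ (x₀ + r • θ.1) ^ Module.finrank ℝ V ∂μ.toSphere := by
  have : Nontrivial V := Module.nontrivial_of_finrank_pos (R := ℝ) (by lia)
  have hunit {x : V} (hx : x ∈ Metric.sphere x₀ r) :
      ‖r⁻¹ • (x - x₀)‖ = 1 ∧ x₀ + r • r⁻¹ • (x - x₀) = x := by
    rw [norm_smul, mem_sphere_iff_norm.1 hx, norm_inv, Real.norm_of_nonneg hr.le,
      inv_mul_cancel₀ hr.ne', smul_inv_smul₀ hr.ne', add_sub_cancel]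
    exact ⟨rfl, rfl⟩
  obtain ⟨u, hu, hcu, hku⟩ :=
    exists_norm_eq_one_inner_nonneg hV (r⁻¹ • (c - x₀)) (r⁻¹ • (k - x₀))
  rw [← (hunit hc).2, ← (hunit hk).2] at h
  have hg : Measurable fun θ : V => ENNReal.ofReal r * ρ (x₀ + r • θ) :=
    (hρ.comp (by fun_prop)).const_mul _
  have hball := measure_ball_le_of_one_le_lintegral_segments μ hg
    (hunit hc).1 (hunit hk).1 hu rfl fun z hz =>
      h.one_le_lintegral_normalize hr (hunit hc).1 (hunit hk).1 hu hcu hku hz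
  rw [ENNReal.ofReal_natCast] at hball
  simp only [ENNReal.rpow_natCast, mul_pow] at hball
  rw [lintegral_const_mul' _ _ (ENNReal.pow_ne_top ENNReal.ofReal_ne_top)] at hball
  exact div_pow_le_of_le_mul_rpow (Metric.measure_ball_pos _ _ (by positivity)).ne'
    measure_ball_lt_top.ne (by lia) hball

theorem sphereEnergyBound_mul_log_le (hV : 2 ≤ Module.finrank ℝ V) (hρ : Measurable ρ) {x₀ : V}
    {a b : ℝ} (ha : 0 < a) (hab : a ≤ b)
    (h : ∀ r ∈ Ioo a b, ∃ c ∈ Metric.sphere x₀ r, ∃ k ∈ Metric.sphere x₀ r,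
      SeparatesPoints ρ c k) :
    sphereEnergyBound μ * ENNReal.ofReal (Real.log (b / a)) ≤
      ∫⁻ x, ρ x ^ Module.finrank ℝ V ∂μ := by
  have : Nontrivial V := Module.nontrivial_of_finrank_pos (R := ℝ) (by lia)
  set d := Module.finrank ℝ V
  have hslice {r : ℝ} (hr : r ∈ Ioo a b) : sphereEnergyBound μ * ENNReal.ofReal r⁻¹ ≤
      ENNReal.ofReal (r ^ (d - 1)) * ∫⁻ θ, ρ (x₀ + r • θ.1) ^ d ∂μ.toSphere := by
    have hr0 : 0 < r := ha.trans hr.1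
    obtain ⟨c, hc, k, hk, hsep⟩ := h r hr
    calc sphereEnergyBound μ * ENNReal.ofReal r⁻¹
        ≤ (ENNReal.ofReal r ^ d * ∫⁻ θ, ρ (x₀ + r • θ.1) ^ d ∂μ.toSphere) *
            ENNReal.ofReal r⁻¹ := mul_le_mul_left (sphereEnergyBound_le μ hV hρ hr0 hc hk hsep) _
      _ = _ := by
          rw [mul_right_comm, ← ENNReal.ofReal_pow hr0.le, ← ENNReal.ofReal_mul (by positivity),
            ← pow_sub_one_mul (by lia : d ≠ 0) r, mul_inv_cancel_right₀ hr0.ne']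
  calc sphereEnergyBound μ * ENNReal.ofReal (Real.log (b / a))
      = ∫⁻ r in Ioo a b, sphereEnergyBound μ * ENNReal.ofReal r⁻¹ := by
        rw [lintegral_const_mul _ (by fun_prop), lintegral_Ioo_inv ha hab]
    _ ≤ ∫⁻ r in Ioo a b, ENNReal.ofReal (r ^ (d - 1)) *
          ∫⁻ θ, ρ (x₀ + r • θ.1) ^ d ∂μ.toSphere :=
        setLIntegral_mono' measurableSet_Ioo fun r hr => hslice hr
    _ ≤ ∫⁻ r in Ioi (0 : ℝ), ENNReal.ofReal (r ^ (d - 1)) *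
          ∫⁻ θ, ρ (x₀ + r • θ.1) ^ d ∂μ.toSphere :=
        lintegral_mono_set fun r hr => ha.trans hr.1
    _ = ∫⁻ x, ρ x ^ d ∂μ := (lintegral_eq_lintegral_toSphere μ (hρ.pow_const d) x₀).symm

end SphereEnergy

/-! ### Paths and open closed maps -/

theorem exists_mem_Icc_mapsTo_notMem {X : Type*} [TopologicalSpace X] {γ : ℝ → X} {s T : ℝ}
    (hsT : s ≤ T) (hγ : ContinuousOn γ (Icc s T)) {D K : Set X} (hD : IsOpen D) (hK : IsClosed K)
    (hKD : K ⊆ D) (hs : γ s ∈ D) (hT : γ T ∉ D) :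
    ∃ t ∈ Icc s T, MapsTo γ (Icc s t) D ∧ γ t ∉ K := by
  obtain ⟨T', ⟨hT', hT'D⟩, hmin⟩ : ∃ T', IsLeast (Icc s T ∩ γ ⁻¹' Dᶜ) T' :=
    (isCompact_Icc.of_isClosed_subset
      (hγ.preimage_isClosed_of_isClosed isClosed_Icc hD.isClosed_compl)
      inter_subset_left).exists_isLeast ⟨T, right_mem_Icc.2 hsT, hT⟩
  have hlt : s < T' := hT'.1.lt_of_ne fun h => hT'D (h ▸ hs)
  have hsub : Icc s T' ⊆ Icc s T := Icc_subset_Icc_right hT'.2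
  have hmaps : MapsTo γ (Ico s T') D := fun t ht => by_contra fun hcon =>
    (hmin ⟨hsub (Ico_subset_Icc_self ht), hcon⟩).not_gt ht.2
  by_contra! hcon
  have hlim : Tendsto γ (𝓝[<] T') (𝓝 (γ T')) :=
    ((hγ.mono hsub T' (right_mem_Icc.2 hlt.le)).mono Ico_subset_Icc_self).tendsto.mono_left
      (nhdsWithin_Ico_eq_nhdsLT hlt).ge
  refine hT'D (hKD (hK.mem_of_tendsto hlim ?_))
  filter_upwards [Ico_mem_nhdsLT hlt] with t ht
  exact hcon t (hsub (Ico_subset_Icc_self ht)) (hmaps.mono_left (Icc_subset_Ico_right ht.2))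

theorem exists_crossing {g : ℝ → ℝ} {s T r₁ r₂ : ℝ} (hsT : s ≤ T) (hg : ContinuousOn g (Icc s T))
    (h₁ : g s ≤ r₁) (h₁₂ : r₁ < r₂) (h₂ : r₂ ≤ g T) :
    ∃ a b, s ≤ a ∧ a < b ∧ b ≤ T ∧ g a = r₁ ∧ g b = r₂ ∧ MapsTo g (Ioo a b) (Ioo r₁ r₂) := by
  obtain ⟨b, ⟨hb, hgb⟩, hbmin⟩ : ∃ b, IsLeast (Icc s T ∩ g ⁻¹' {r₂}) b := by
    obtain ⟨t, ht, htr⟩ := intermediate_value_Icc hsT hg ⟨h₁.trans h₁₂.le, h₂⟩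
    exact (isCompact_Icc.of_isClosed_subset (hg.preimage_isClosed_of_isClosed isClosed_Icc
      isClosed_singleton) inter_subset_left).exists_isLeast ⟨t, ht, htr⟩
  have hg' : ContinuousOn g (Icc s b) := hg.mono (Icc_subset_Icc_right hb.2)
  obtain ⟨a, ⟨ha, hga⟩, hamax⟩ : ∃ a, IsGreatest (Icc s b ∩ g ⁻¹' {r₁}) a := by
    obtain ⟨t, ht, htr⟩ := intermediate_value_Icc hb.1 hg' ⟨h₁, h₁₂.le.trans_eq hgb.symm⟩
    exact (isCompact_Icc.of_isClosed_subset (hg'.preimage_isClosed_of_isClosed isClosed_Icc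
      isClosed_singleton) inter_subset_left).exists_isGreatest ⟨t, ht, htr⟩
  have hab : a < b := ha.2.lt_of_ne fun h => h₁₂.ne (by rw [← hga, ← hgb, h])
  refine ⟨a, b, ha.1, hab, hb.2, hga, hgb, fun t ht => ⟨?_, ?_⟩⟩
  · by_contra! hle
    obtain ⟨u, hu, hgu⟩ := intermediate_value_Icc ht.2.le
      (hg'.mono (Icc_subset_Icc_left (ha.1.trans ht.1.le))) ⟨hle, h₁₂.le.trans_eq hgb.symm⟩
    exact (hamax ⟨⟨ha.1.trans (ht.1.le.trans hu.1), hu.2⟩, hgu⟩).not_gt (ht.1.trans_le hu.1)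
  · by_contra! hle
    obtain ⟨u, hu, hgu⟩ := intermediate_value_Icc ht.1.le
      (hg'.mono (Icc_subset_Icc ha.1 ht.2.le)) ⟨(hga.trans_lt h₁₂).le, hle⟩
    exact (hbmin ⟨⟨ha.1.trans hu.1, hu.2.trans (ht.2.le.trans hb.2)⟩, hgu⟩).not_gt
      (hu.2.trans_lt ht.2)

theorem mapClusterPt_atTop_of_mem_closure_range {X : Type*} [TopologicalSpace X] [T1Space X]
    {x : ℕ → X} {p : X} (hp : p ∈ closure (range x)) (hne : p ∉ range x) :
    MapClusterPt p atTop x := by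
  refine mapClusterPt_atTop_iff_forall_mem_closure.2 fun N => ?_
  have hsplit : range x = x '' Iio N ∪ x '' Ici N := by
    rw [← image_union, Iio_union_Ici, image_univ]
  rw [hsplit, closure_union, ((finite_Iio N).image x).isClosed.closure_eq] at hp
  exact hp.resolve_left fun h => hne (image_subset_range x _ h)

section OpenClosedMaps

variable {n : ℕ} {D : Set (Rn n)} {f : Rn n → Rn n}

theorem OpenMapOn.frequently_ne [NeZero n] (hf : OpenMapOn D f) {x : Rn n} (hx : D ∈ 𝓝 x)
    (y : Rn n) : ∃ᶠ x' in 𝓝 x, f x' ≠ y := fun hev => by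
  obtain ⟨U, hU, hUo, hxU⟩ := mem_nhds_iff.1 (hev.and hx)
  have himage : f '' U = {y} := by
    refine Subset.antisymm (image_subset_iff.2 fun z hz => not_not.1 (hU hz).1) ?_
    exact singleton_subset_iff.2 ⟨x, hxU, not_not.1 (hU hxU).1⟩
  exact not_isOpen_singleton y (himage ▸ hf U (fun z hz => (hU hz).2) hUo)

theorem ClosedMapOn.exists_mapClusterPt (hf : ClosedMapOn D f) {x : ℕ → Rn n} (hx : ∀ k, x k ∈ D)
    {y : Rn n} (hy : y ∈ f '' D) (hlim : Tendsto (fun k => f (x k)) atTop (𝓝 y))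
    (hne : ∀ k, f (x k) ≠ y) : ∃ p ∈ D, MapClusterPt p atTop x := by
  obtain ⟨C, hC, himage⟩ := hf (closure (range x)) isClosed_closure
  have hxC (k : ℕ) : f (x k) ∈ C :=
    (himage.subset (mem_image_of_mem f ⟨hx k, subset_closure (mem_range_self k)⟩)).2
  obtain ⟨p, ⟨hpD, hp⟩, rfl⟩ :=
    himage.superset ⟨hy, hC.mem_of_tendsto hlim (Eventually.of_forall hxC)⟩
  refine ⟨p, hpD, mapClusterPt_atTop_of_mem_closure_range hp ?_⟩
  rintro ⟨k, rfl⟩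
  exact hne k rfl

theorem OpenMapOn.exists_tendsto_dist_ne [NeZero n] (hopen : OpenMapOn D f) (hD : IsOpen D)
    (hf : ContinuousOn f D) {x : ℕ → Rn n} (hx : ∀ k, x k ∈ D) (y : Rn n) :
    ∃ x' : ℕ → Rn n, (∀ k, x' k ∈ D) ∧ (∀ k, f (x' k) ≠ y) ∧
      Tendsto (fun k => dist (x' k) (x k)) atTop (𝓝 0) ∧
      Tendsto (fun k => dist (f (x' k)) (f (x k))) atTop (𝓝 0) := by
  have hnear (k : ℕ) : ∃ x', f x' ≠ y ∧ x' ∈ D ∧ dist x' (x k) < 1 / ((k : ℝ) + 1) ∧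
      dist (f x') (f (x k)) < 1 / ((k : ℝ) + 1) := by
    have hDx : D ∈ 𝓝 (x k) := hD.mem_nhds (hx k)
    have hε : 0 < 1 / ((k : ℝ) + 1) := Nat.one_div_pos_of_nat
    have hball : ∀ᶠ x' in 𝓝 (x k), dist x' (x k) < 1 / ((k : ℝ) + 1) :=
      Metric.ball_mem_nhds _ hε
    have hballf : ∀ᶠ x' in 𝓝 (x k), dist (f x') (f (x k)) < 1 / ((k : ℝ) + 1) :=
      (hf.continuousAt hDx).preimage_mem_nhds (Metric.ball_mem_nhds _ hε)
    exact ((hopen.frequently_ne hDx y).and_eventually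
      (Eventually.and hDx (hball.and hballf))).exists
  choose x' hne hx'D hdist hdistf using hnear
  have hlim := tendsto_one_div_add_atTop_nhds_zero_nat (𝕜 := ℝ)
  exact ⟨x', hx'D, hne, squeeze_zero (fun _ => dist_nonneg) (fun k => (hdist k).le) hlim,
    squeeze_zero (fun _ => dist_nonneg) (fun k => (hdistf k).le) hlim⟩

theorem isCompact_inter_preimage [NeZero n] (hD : IsOpen D) (hf : ContinuousOn f D)
    (hopen : OpenMapOn D f) (hclosed : ClosedMapOn D f) {K : Set (Rn n)} (hK : IsCompact K)
    (hKD : K ⊆ f '' D) : IsCompact (D ∩ f ⁻¹' K) := by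
  refine IsSeqCompact.isCompact fun x hx => ?_
  obtain ⟨y, hy, φ, hφ, hlim⟩ := hK.tendsto_subseq fun k => (hx k).2
  obtain ⟨x', hx'D, hne, hdist, hdistf⟩ :=
    hopen.exists_tendsto_dist_ne hD hf (fun k => (hx (φ k)).1) y
  have hlim' : Tendsto (fun k => f (x' k)) atTop (𝓝 y) :=
    hlim.congr_dist (hdistf.congr fun _ => dist_comm _ _)
  obtain ⟨p, hp, hcluster⟩ := hclosed.exists_mapClusterPt hx'D (hKD hy) hlim' hne
  obtain ⟨ψ, hψ, hψlim⟩ := hcluster.tendsto_subseq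
  have hfp : f p = y := tendsto_nhds_unique
    ((hf.continuousAt (hD.mem_nhds hp)).tendsto.comp hψlim) (hlim'.comp hψ.tendsto_atTop)
  refine ⟨p, ⟨hp, mem_preimage.2 (hfp ▸ hy)⟩, φ ∘ ψ, hφ.comp hψ,
    hψlim.congr_dist (hdist.comp hψ.tendsto_atTop)⟩

theorem exists_subpath_mem_liftedRingPaths [NeZero n] (hD : IsOpen D) (hf : ContinuousOn f D)
    (hopen : OpenMapOn D f) (hclosed : ClosedMapOn D f) {γ : ℝ → Rn n} {s T : ℝ} (hsT : s ≤ T)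
    (hγ : ContinuousOn γ (Icc s T)) (hs : γ s ∈ D) (hT : γ T ∉ D) {y : Rn n} {r₁ r₂ : ℝ}
    (h₁₂ : r₁ < r₂) (hball : Metric.closedBall y r₂ ⊆ f '' D)
    (hstart : f (γ s) ∈ Metric.closedBall y r₁) :
    ∃ p ∈ liftedRingPaths D f y r₁ r₂, p.toFun = γ ∧ Icc p.a p.b ⊆ Icc s T := by
  have hcompact := isCompact_inter_preimage hD hf hopen hclosed (isCompact_closedBall y r₂) hball
  obtain ⟨t, ht, hmaps, hfar⟩ := exists_mem_Icc_mapsTo_notMem hsT hγ hD hcompact.isClosed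
    inter_subset_left hs hT
  have hfar' : r₂ < dist (f (γ t)) y :=
    not_le.1 fun h => hfar ⟨hmaps (right_mem_Icc.2 ht.1), h⟩
  have hsub : Icc s t ⊆ Icc s T := Icc_subset_Icc_right ht.2
  have hdist : ContinuousOn (fun t => dist (f (γ t)) y) (Icc s t) :=
    (continuous_id.dist continuous_const).comp_continuousOn (hf.comp (hγ.mono hsub) hmaps)
  obtain ⟨a, b, hsa, hab, hbt, hga, hgb, hring⟩ := exists_crossing ht.1 hdist hstart h₁₂ hfar'.le
  have hsub' : Icc a b ⊆ Icc s t := Icc_subset_Icc hsa hbt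
  exact ⟨⟨a, b, hab, γ, hγ.mono (hsub'.trans hsub)⟩,
    ⟨fun t ht => hmaps (hsub' ht), hga, hgb, hring⟩, rfl, hsub'.trans hsub⟩

end OpenClosedMaps

/-! ### Modulus of path families -/

section Modulus

variable {n : ℕ}

theorem Admissible.mono {Γ Γ' : Set (ClosedPath n)} (hΓ : Γ' ⊆ Γ) {ρ ρ' : Rn n → ℝ≥0∞}
    (h : Admissible Γ ρ) (hρ' : Measurable ρ') (hle : ρ ≤ ρ') : Admissible Γ' ρ' :=
  ⟨hρ', fun γ hγ hrect => (h.2 γ (hΓ hγ) hrect).trans (lintegral_mono fun _ => hle _)⟩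

theorem modulus_empty (hn : n ≠ 0) : modulus (∅ : Set (ClosedPath n)) = 0 := by
  have h0 : Admissible (∅ : Set (ClosedPath n)) 0 := ⟨measurable_const, fun γ hγ => hγ.elim⟩
  exact le_bot_iff.1 ((iInf₂_le 0 h0).trans_eq (by simp [hn]))

theorem modulus_union_le (Γ Γ' : Set (ClosedPath n)) :
    modulus (Γ ∪ Γ') ≤ modulus Γ + modulus Γ' := by
  refine ENNReal.le_iInf₂_add_iInf₂ fun ρ hρ ρ' hρ' => ?_
  have hsup : Admissible (Γ ∪ Γ') (ρ ⊔ ρ') := by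
    refine ⟨hρ.1.sup hρ'.1, ?_⟩
    rintro γ (hγ | hγ) hrect
    · exact (hρ.mono Subset.rfl (hρ.1.sup hρ'.1) le_sup_left).2 γ hγ hrect
    · exact (hρ'.mono Subset.rfl (hρ.1.sup hρ'.1) le_sup_right).2 γ hγ hrect
  calc modulus (Γ ∪ Γ') ≤ ∫⁻ x, (ρ ⊔ ρ') x ^ n := iInf₂_le _ hsup
    _ ≤ ∫⁻ x, (ρ x ^ n + ρ' x ^ n) := by
        refine lintegral_mono fun x => ?_
        rcases le_total (ρ x) (ρ' x) with h | h <;> simp [h]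
    _ = (∫⁻ x, ρ x ^ n) + ∫⁻ x, ρ' x ^ n := lintegral_add_left (hρ.1.pow_const n) _

theorem modulus_biUnion_finset_le (hn : n ≠ 0) {ι : Type*} (t : Finset ι)
    (Γ : ι → Set (ClosedPath n)) : modulus (⋃ i ∈ t, Γ i) ≤ ∑ i ∈ t, modulus (Γ i) := by
  classical
  induction t using Finset.induction_on with
  | empty => simp [modulus_empty hn]
  | insert i t hi ih =>
    rw [Finset.set_biUnion_insert, Finset.sum_insert hi]
    exact (modulus_union_le _ _).trans (add_le_add_right ih _)

/-- Every path from `c` to `k` has a subpath in `Γ`. -/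
def Minorizes (Γ : Set (ClosedPath n)) (c k : Rn n) : Prop :=
  ∀ (γ : ℝ → Rn n) (s T : ℝ), s ≤ T → ContinuousOn γ (Icc s T) → γ s = c → γ T = k →
    ∃ p ∈ Γ, p.toFun = γ ∧ Icc p.a p.b ⊆ Icc s T

theorem Minorizes.separatesPoints {Γ : Set (ClosedPath n)} {c k : Rn n} (h : Minorizes Γ c k)
    {ρ : Rn n → ℝ≥0∞} (hρ : Admissible Γ ρ) : SeparatesPoints ρ c k := by
  intro γ L s T hsT hL hs hT
  obtain ⟨p, hp, rfl, hsub⟩ := h γ s T hsT hL.continuousOn hs hT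
  have hLp : LipschitzOnWith L p.toFun (Icc p.a p.b) := hL.mono hsub
  have hrect : p.Rectifiable := by
    have hbv := hLp.locallyBoundedVariationOn p.a p.b (left_mem_Icc.2 p.lt.le)
      (right_mem_Icc.2 p.lt.le)
    rwa [inter_self] at hbv
  calc 1 ≤ p.lineIntegral ρ := hρ.2 p hp hrect
    _ ≤ L * ∫⁻ t in Icc p.a p.b, ρ (p.toFun t) := p.lineIntegral_le_of_lipschitzOnWith hLp ρ
    _ ≤ L * ∫⁻ t in Icc s T, ρ (p.toFun t) := mul_le_mul_right (lintegral_mono_set hsub) _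

theorem sphereEnergyBound_mul_log_le_modulus (hn : 2 ≤ n) {Γ : Set (ClosedPath n)} {x : Rn n}
    {a b : ℝ} (ha : 0 < a) (hab : a ≤ b)
    (h : ∀ r ∈ Ioo a b, ∃ c ∈ Metric.sphere x r, ∃ k ∈ Metric.sphere x r, Minorizes Γ c k) :
    sphereEnergyBound (volume : Measure (Rn n)) * ENNReal.ofReal (Real.log (b / a)) ≤
      modulus Γ := by
  have hfinrank : Module.finrank ℝ (Rn n) = n := finrank_euclideanSpace_fin
  refine le_iInf₂ fun ρ hρ => ?_
  have hbound := sphereEnergyBound_mul_log_le volume (hn.trans_eq hfinrank.symm) hρ.1 ha hab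
    fun r hr => (h r hr).imp fun c ⟨hc, k, hk, hck⟩ => ⟨hc, k, hk, hck.separatesPoints hρ⟩
  rwa [hfinrank] at hbound

end Modulus

/-! ### Rings and boundary points -/

section Rings

variable {V : Type*}

/-- No ring `{z | a < |z - x| < q a}` has both a point of `A` and a point outside `D` on each of
its spheres about `x`. -/
def RingRatioBound [PseudoMetricSpace V] (q : ℝ) (A D : Set V) : Prop :=
  ∀ (x : V) (a : ℝ), 0 < a → (∀ r ∈ Ioo a (q * a), ∃ c ∈ Metric.sphere x r, c ∈ A) →
    ∃ r ∈ Ioo a (q * a), Metric.sphere x r ⊆ D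

/-- The frontier of every open set that meets `A` and misses `P` meets `A`. This holds for instance
if every component of `A` meets `P`. -/
def ConnectsTo [TopologicalSpace V] (A P : Set V) : Prop :=
  ∀ U, IsOpen U → (A ∩ U).Nonempty → Disjoint P U → (A ∩ frontier U).Nonempty

variable [NormedAddCommGroup V] [NormedSpace ℝ V] {q : ℝ} {A P D : Set V}

theorem RingRatioBound.disjoint_ball (h : RingRatioBound q A D) (hq : 0 < q)
    (hAP : ConnectsTo A P) {x : V} {R : ℝ} (hR : 0 < R)
    (hD : ∀ r, 0 < r → r < R → ∃ k ∈ Metric.sphere x r, k ∉ D) (hP : Disjoint P (Metric.ball x R)) :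
    Disjoint A (Metric.ball x (R / q)) := by
  refine disjoint_left.2 fun z hzA hz => ?_
  have ha : 0 < R / q := by positivity
  have hqR : q * (R / q) = R := mul_div_cancel₀ R hq.ne'
  have hmeet : ∀ r ∈ Ioo (R / q) R, ∃ c ∈ Metric.sphere x r, c ∈ A := fun r hr => by
    obtain ⟨c, hcA, hc⟩ := hAP (Metric.ball x r) Metric.isOpen_ball
      ⟨z, hzA, Metric.ball_subset_ball hr.1.le hz⟩
      (hP.mono_right (Metric.ball_subset_ball hr.2.le))
    rw [frontier_ball x (ha.trans hr.1).ne'] at hc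
    exact ⟨c, hc, hcA⟩
  obtain ⟨r, hr, hsub⟩ := h x (R / q) ha (hqR.symm ▸ hmeet)
  rw [hqR] at hr
  obtain ⟨k, hk, hkD⟩ := hD r (ha.trans hr.1) hr.2
  exact hkD (hsub hk)

theorem RingRatioBound.subset_closedBall (h : RingRatioBound q A D)
    (hAP : ConnectsTo A P) {x : V} {R : ℝ} (hR : 0 < R)
    (hD : ∀ r, R < r → ∃ k ∈ Metric.sphere x r, k ∉ D) (hP : P ⊆ Metric.closedBall x R) :
    A ⊆ Metric.closedBall x (q * R) := by
  by_contra hA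
  obtain ⟨z, hzA, hz⟩ := not_subset.1 hA
  have hmeet : ∀ r ∈ Ioo R (q * R), ∃ c ∈ Metric.sphere x r, c ∈ A := fun r hr => by
    obtain ⟨c, hcA, hc⟩ := hAP (Metric.closedBall x r)ᶜ Metric.isClosed_closedBall.isOpen_compl
      ⟨z, hzA, fun hzr => hz (Metric.closedBall_subset_closedBall hr.2.le hzr)⟩
      (disjoint_compl_right_iff_subset.2
        (hP.trans (Metric.closedBall_subset_closedBall hr.1.le)))
    rw [frontier_compl, frontier_closedBall x (hR.trans hr.1).ne'] at hc
    exact ⟨c, hc, hcA⟩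
  obtain ⟨r, hr, hsub⟩ := h x R hR hmeet
  obtain ⟨k, hk, hkD⟩ := hD r hr.1
  exact hkD (hsub hk)

end Rings

section Boundary

variable {n : ℕ} {ι : Type*} {A P : ι → Set (Rn n)} {D : Set (Rn n)} {q : ℝ}
  (hD : IsOpen D) (hbdry : BoundaryNondegenerate D) (hA : ∀ i, RingRatioBound q (A i) D)
  (hAP : ∀ i, ConnectsTo (A i) (P i))
include hD hbdry hA hAP

theorem eventually_coe_notMem_toExt (hq : 0 < q) {x : Rn n} (hx : (x : RnExt n) ∈ extBoundary D)
    (hP : ∀ᶠ z in 𝓝 (x : RnExt n), ∀ i, z ∉ toExt (P i)) :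
    ∀ᶠ z in 𝓝 (x : RnExt n), ∀ i, z ∉ toExt (A i) := by
  obtain ⟨R₁, hR₁, hout⟩ := hbdry.exists_forall_lt_sphere hD hx
  obtain ⟨R₂, hR₂, hfar⟩ := Metric.eventually_nhds_iff_ball.1
    (OnePoint.continuous_coe.continuousAt.eventually hP)
  have hR : 0 < min R₁ R₂ := lt_min hR₁ hR₂
  have hball : toExt (Metric.ball x (min R₁ R₂ / q)) ∈ 𝓝 (x : RnExt n) :=
    (isOpen_toExt Metric.isOpen_ball).mem_nhds
      (coe_mem_toExt.2 (Metric.mem_ball_self (by positivity)))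
  filter_upwards [hball] with _ ⟨z, hz, hzx⟩ i hzA
  subst hzx
  refine ((hA i).disjoint_ball hq (hAP i) hR (fun r hr0 hr => hout r hr0 (lt_min_iff.1 hr).1)
    ?_).ne_of_mem (coe_mem_toExt.1 hzA) hz rfl
  exact disjoint_left.2 fun w hwP hw =>
    hfar w (Metric.ball_subset_ball (min_le_right _ _) hw) i (coe_mem_toExt.2 hwP)

theorem eventually_infty_notMem_toExt (hinfty : (OnePoint.infty : RnExt n) ∈ extBoundary D)
    (hP : ∀ᶠ z in 𝓝 (OnePoint.infty : RnExt n), ∀ i, z ∉ toExt (P i)) :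
    ∀ᶠ z in 𝓝 (OnePoint.infty : RnExt n), ∀ i, z ∉ toExt (A i) := by
  obtain ⟨R₁, hR₁, hout⟩ := hbdry.exists_forall_gt_sphere hD hinfty 0
  have hP' : ∀ᶠ z : Rn n in cocompact (Rn n), ∀ i, z ∉ P i := by
    rw [← coclosedCompact_eq_cocompact]
    filter_upwards [OnePoint.tendsto_coe_infty.eventually hP] with z hz i hzP
    exact hz i (coe_mem_toExt.2 hzP)
  obtain ⟨R₂, -, hfar⟩ := (Metric.hasBasis_cobounded_compl_closedBall (0 : Rn n)).mem_iff.1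
    (Metric.cobounded_eq_cocompact (α := Rn n) ▸ hP')
  filter_upwards [(isOpen_compl_toExt (isCompact_closedBall (0 : Rn n)
    (q * max R₁ R₂))).mem_nhds OnePoint.infty_notMem_image_coe] with z hz i hzA
  refine hz (image_mono ((hA i).subset_closedBall (hAP i) (lt_max_of_lt_left hR₁)
    (fun r hr => hout r ((le_max_left _ _).trans_lt hr)) fun w hwP => ?_) hzA)
  by_contra hw
  exact hfar (fun hwR => hw (Metric.closedBall_subset_closedBall (le_max_right _ _) hwR)) i hwP

theorem disjoint_closure_iUnion_extBoundary (hq : 0 < q)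
    (hP : ∀ b ∈ extBoundary D, ∀ᶠ z in 𝓝 b, ∀ i, z ∉ toExt (P i)) :
    Disjoint (closure (⋃ i, toExt (A i))) (extBoundary D) := by
  refine disjoint_right.2 fun b hb hcl => mem_closure_iff_frequently.1 hcl ?_
  suffices h : ∀ᶠ z in 𝓝 b, ∀ i, z ∉ toExt (A i) by
    simpa only [mem_iUnion, not_exists] using h
  induction b using OnePoint.rec with
  | infty => exact eventually_infty_notMem_toExt hD hbdry hA hAP hb (hP _ hb)
  | coe x => exact eventually_coe_notMem_toExt hD hbdry hA hAP hq hb (hP _ hb)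

end Boundary

/-! ### Preimages of compact sets -/

theorem exists_isCompact_isPreconnected_superset {X : Type*} [TopologicalSpace X] [T2Space X]
    [LocallyCompactSpace X] [LocallyPathConnectedSpace X] {D K : Set X} (hD : IsOpen D)
    (hDconn : IsConnected D) (hK : IsCompact K) (hKD : K ⊆ D) {e : X} (he : e ∈ D) :
    ∃ F ⊆ D, IsCompact F ∧ IsPreconnected F ∧ e ∈ F ∧ K ⊆ F := by
  refine hK.induction_on (p := fun s => ∃ F ⊆ D, IsCompact F ∧ IsPreconnected F ∧ e ∈ F ∧ s ⊆ F)
    ⟨{e}, singleton_subset_iff.2 he, isCompact_singleton, isPreconnected_singleton,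
      mem_singleton e, empty_subset _⟩
    (fun s t hst ⟨F, hFD, hF, hFconn, heF, htF⟩ => ⟨F, hFD, hF, hFconn, heF, hst.trans htF⟩)
    (fun s t ⟨F, hFD, hF, hFconn, heF, hsF⟩ ⟨G, hGD, hG, hGconn, heG, htG⟩ =>
      ⟨F ∪ G, union_subset hFD hGD, hF.union hG, hFconn.union e heF heG hGconn, Or.inl heF,
        union_subset_union hsF htG⟩)
    fun y hy => ?_
  obtain ⟨L, hL, hLD, hLcomp⟩ := local_compact_nhds (hD.mem_nhds (hKD hy))
  obtain ⟨U, ⟨hU, hUconn⟩, hUL⟩ := (LocallyPathConnectedSpace.path_connected_basis y).mem_iff.1 hL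
  obtain ⟨γ, hγ⟩ := (hD.isConnected_iff_isPathConnected.1 hDconn).joinedIn e he y (hKD hy)
  have hcl : closure U ⊆ L := closure_minimal hUL hLcomp.isClosed
  refine ⟨U, mem_nhdsWithin_of_mem_nhds hU, range γ ∪ closure U,
    union_subset (range_subset_iff.2 hγ) (hcl.trans hLD),
    (isCompact_range γ.continuous).union (hLcomp.of_isClosed_subset isClosed_closure hcl), ?_,
    Or.inl ⟨0, γ.source⟩, subset_closure.trans subset_union_right⟩
  exact (isPreconnected_range γ.continuous).union y ⟨1, γ.target⟩
    (subset_closure (mem_of_mem_nhds hU)) hUconn.isConnected.isPreconnected.closure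

section Preimages

variable {n : ℕ} {D : Set (Rn n)} {f : Rn n → Rn n}

theorem connectsTo_inter_preimage (hD : IsOpen D) (hopen : OpenMapOn D f)
    (hclosed : ClosedMapOn D f) {F P : Set (Rn n)} (hF : IsPreconnected F) (hFD : F ⊆ f '' D)
    (hFP : (F ∩ P).Nonempty) : ConnectsTo (D ∩ f ⁻¹' F) (D ∩ f ⁻¹' P) := by
  rintro U hU ⟨x, ⟨hxD, hxF⟩, hxU⟩ hdisj
  by_contra hfr
  obtain ⟨C, hC, himage⟩ := hclosed (closure U) isClosed_closure
  have hUC : f '' (D ∩ U) ⊆ C :=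
    (image_mono (inter_subset_inter_right D subset_closure)).trans
      (himage.subset.trans inter_subset_right)
  have hcover : F ⊆ f '' (D ∩ U) ∪ Cᶜ := fun y hy => by
    refine or_iff_not_imp_right.2 fun hyC => ?_
    obtain ⟨z, ⟨hzD, hz⟩, rfl⟩ := himage.superset ⟨hFD hy, not_not.1 hyC⟩
    refine mem_image_of_mem f ⟨hzD, by_contra fun hzU => hfr ⟨z, ⟨hzD, hy⟩, ?_⟩⟩
    exact hU.frontier_eq ▸ ⟨hz, hzU⟩
  obtain ⟨_, hyF, hyP⟩ := hFP
  obtain ⟨z, ⟨hzD, hzU⟩, rfl⟩ := hF.subset_left_of_subset_union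
    (hopen _ inter_subset_left (hD.inter hU)) hC.isOpen_compl
    (disjoint_compl_right_iff_subset.2 hUC) hcover ⟨f x, hxF, mem_image_of_mem f ⟨hxD, hxU⟩⟩ hyF
  exact hdisj.ne_of_mem ⟨hzD, hyP⟩ hzU rfl

theorem minorizes_biUnion_liftedRingPaths [NeZero n] (hD : IsOpen D) (hf : ContinuousOn f D)
    (hopen : OpenMapOn D f) (hclosed : ClosedMapOn D f) {t : Set (Rn n)} {r₁ r₂ : Rn n → ℝ}
    (hr : ∀ y ∈ t, r₁ y < r₂ y) (hball : ∀ y ∈ t, Metric.closedBall y (r₂ y) ⊆ f '' D)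
    {c k : Rn n} (hc : c ∈ D) (hfc : f c ∈ ⋃ y ∈ t, Metric.closedBall y (r₁ y)) (hk : k ∉ D) :
    Minorizes (⋃ y ∈ t, liftedRingPaths D f y (r₁ y) (r₂ y)) c k := by
  rintro γ s T hsT hγ rfl rfl
  obtain ⟨y, hy, hfcy⟩ := mem_iUnion₂.1 hfc
  obtain ⟨p, hp, hpγ⟩ := exists_subpath_mem_liftedRingPaths hD hf hopen hclosed hsT hγ hc hk
    (hr y hy) (hball y hy) hfcy
  exact ⟨p, mem_iUnion₂.2 ⟨y, hy, hp⟩, hpγ⟩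

theorem ringRatioBound_of_modulus_lt (hn : 2 ≤ n) (hD : IsOpen D) (hf : ContinuousOn f D)
    (hopen : OpenMapOn D f) (hclosed : ClosedMapOn D f) {t : Set (Rn n)} {r₁ r₂ : Rn n → ℝ}
    (hr : ∀ y ∈ t, r₁ y < r₂ y) (hball : ∀ y ∈ t, Metric.closedBall y (r₂ y) ⊆ f '' D)
    {F : Set (Rn n)} (hF : F ⊆ ⋃ y ∈ t, Metric.closedBall y (r₁ y)) {N : ℕ}
    (hmod : modulus (⋃ y ∈ t, liftedRingPaths D f y (r₁ y) (r₂ y)) <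
      N * sphereEnergyBound (volume : Measure (Rn n))) :
    RingRatioBound (Real.exp N) (D ∩ f ⁻¹' F) D := by
  have : NeZero n := ⟨by lia⟩
  intro x a ha hmeet
  by_contra! hout
  refine hmod.not_ge ?_
  calc (N : ℝ≥0∞) * sphereEnergyBound (volume : Measure (Rn n))
      = sphereEnergyBound (volume : Measure (Rn n)) *
          ENNReal.ofReal (Real.log (Real.exp N * a / a)) := by
        rw [mul_div_cancel_right₀ _ ha.ne', Real.log_exp, ENNReal.ofReal_natCast, mul_comm]
    _ ≤ modulus (⋃ y ∈ t, liftedRingPaths D f y (r₁ y) (r₂ y)) := by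
        refine sphereEnergyBound_mul_log_le_modulus (x := x) hn ha
          (le_mul_of_one_le_left ha.le (Real.one_le_exp N.cast_nonneg)) fun s hs => ?_
        obtain ⟨c, hc, hcD, hcF⟩ := hmeet s hs
        obtain ⟨k, hk, hkD⟩ := not_subset.1 (hout s hs)
        exact ⟨c, hc, k, hk, minorizes_biUnion_liftedRingPaths hD hf hopen hclosed hr hball hcD
          (hF hcF) hkD⟩

end Preimages

/-- A continuous, open and closed map of `D` onto its image that satisfies the inverse Poletsky
inequality with weight `Q` at all points of `S`. -/
structure IsPoletskyMap {n : ℕ} (D S : Set (Rn n)) (Q : Rn n → ℝ≥0∞) (f : Rn n → Rn n) :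
    Prop where
  continuousOn : ContinuousOn f D
  openMap : OpenMapOn D f
  closedMap : ClosedMapOn D f
  poletsky : ∀ y ∈ S, InversePoletskyAt D Q f y

theorem MemClass.isPoletskyMap {n : ℕ} {E D D₀ : Set (Rn n)} {Q : Rn n → ℝ≥0∞} {δ : ℝ}
    {f : Rn n → Rn n} (h : MemClass E Q δ D D₀ f) : IsPoletskyMap D D₀ Q f :=
  ⟨h.continuousOn, h.openMap, h.closedMap, fun y hy => h.poletsky y (subset_closure hy)⟩

theorem ofReal_lt_iSup_edist {V : Type*} [NormedAddCommGroup V] [NormedSpace ℝ V] [Nontrivial V]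
    {S : Set V} {y : V} {r R : ℝ} (hR : 0 < R) (hrR : r < R) (h : Metric.closedBall y R ⊆ S) :
    ENNReal.ofReal r < ⨆ z ∈ S, edist z y := by
  obtain ⟨z, hz⟩ := (NormedSpace.sphere_nonempty (x := y)).2 hR.le
  calc ENNReal.ofReal r < ENNReal.ofReal R := (ENNReal.ofReal_lt_ofReal_iff hR).2 hrR
    _ = edist z y := by rw [edist_dist, Metric.mem_sphere.1 hz]
    _ ≤ ⨆ z ∈ S, edist z y := le_iSup₂ (f := fun z (_ : z ∈ S) => edist z y) z
        (h (Metric.sphere_subset_closedBall hz))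

section Uniform

variable {n : ℕ} {D₀ : Set (Rn n)} {Q : Rn n → ℝ≥0∞} (hn : 2 ≤ n) (hD₀ : IsOpen D₀)
  (hQ : AEMeasurable Q volume) (hQint : IntegrableOnManySpheres Q D₀)
include hn hD₀ hQ hQint

theorem exists_modulus_liftedRingPaths_le {y : Rn n} (hy : y ∈ D₀) :
    ∃ r > 0, ∃ M ≠ ∞, Metric.closedBall y (3 * r) ⊆ D₀ ∧
      ∀ D f, InversePoletskyAt D Q f y → Metric.closedBall y (3 * r) ⊆ f '' D →
        modulus (liftedRingPaths D f y r (2 * r)) ≤ M := by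
  have : NeZero n := ⟨by lia⟩
  obtain ⟨R, hR, hball⟩ := Metric.nhds_basis_closedBall.mem_iff.1 (hD₀.mem_nhds hy)
  obtain ⟨r, hr, rfl⟩ : ∃ r > 0, 3 * r = R := ⟨R / 3, by positivity, by ring⟩
  have hrad {S : Set (Rn n)} (hS : Metric.closedBall y (3 * r) ⊆ S) :
      ENNReal.ofReal (2 * r) < ⨆ z ∈ S, edist z y :=
    ofReal_lt_iSup_edist hR (by linarith) hS
  obtain ⟨s, hs, hspos, hQs⟩ :=
    hQint y (subset_closure hy) r (2 * r) hr (by linarith) (hrad hball)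
  obtain ⟨η, hη, hη1, hηQ⟩ := exists_weight_lintegral_ring_lt_top hQ hr hs hspos.ne'
    (fun u hu => by simpa only [finrank_euclideanSpace_fin] using (hQs u hu).2) (NeZero.ne n)
  refine ⟨r, hr, _, hηQ.ne, hball, fun D f hf himage => ?_⟩
  exact (hf r (2 * r) hr (by linarith) (hrad himage) η hη.aemeasurable hη1).trans
    (lintegral_mono_set inter_subset_left)

theorem exists_ringRatioBound {F : Set (Rn n)} (hF : IsCompact F) (hFD₀ : F ⊆ D₀) :
    ∃ K ⊆ D₀, IsCompact K ∧ ∃ q > 0, ∀ D f, IsOpen D → IsPoletskyMap D D₀ Q f → K ⊆ f '' D →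
      RingRatioBound q (D ∩ f ⁻¹' F) D := by
  have : NeZero n := ⟨by lia⟩
  choose! r hr M hM hball hmod using
    fun y (hy : y ∈ D₀) => exists_modulus_liftedRingPaths_le hn hD₀ hQ hQint hy
  obtain ⟨t, htF, hcover⟩ := hF.elim_nhds_subcover (fun y => Metric.closedBall y (r y))
    fun y hy => Metric.closedBall_mem_nhds y (hr y (hFD₀ hy))
  have ht (y) (hy : y ∈ t) : y ∈ D₀ := hFD₀ (htF y hy)
  obtain ⟨N, hN⟩ := ENNReal.exists_nat_mul_gt
    (sphereEnergyBound_ne_zero (volume : Measure (Rn n)))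
    (ENNReal.sum_ne_top.2 fun y hy => hM y (ht y hy))
  refine ⟨⋃ y ∈ t, Metric.closedBall y (3 * r y), iUnion₂_subset fun y hy => hball y (ht y hy),
    t.finite_toSet.isCompact_biUnion fun y _ => isCompact_closedBall _ _, Real.exp N,
    Real.exp_pos _, fun D f hD hf hKf => ?_⟩
  have hballf (y) (hy : y ∈ t) : Metric.closedBall y (3 * r y) ⊆ f '' D :=
    (subset_biUnion_of_mem (u := fun y => Metric.closedBall y (3 * r y)) hy).trans hKf
  have hsum : modulus (⋃ y ∈ t, liftedRingPaths D f y (r y) (2 * r y)) ≤ ∑ y ∈ t, M y :=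
    (modulus_biUnion_finset_le (NeZero.ne n) t _).trans (Finset.sum_le_sum fun y hy =>
      hmod y (ht y hy) D f (hf.poletsky y (ht y hy)) (hballf y hy))
  refine ringRatioBound_of_modulus_lt (t := t) (r₂ := fun y => 2 * r y) hn hD hf.continuousOn
    hf.openMap hf.closedMap (fun y hy => ?_) (fun y hy => ?_) hcover (hsum.trans_lt hN)
  · linarith [hr y (ht y hy)]
  · refine (Metric.closedBall_subset_closedBall ?_).trans (hballf y hy)
    linarith [hr y (ht y hy)]

theorem exists_le_chordalDist_preimage (hD₀conn : IsConnected D₀) {D : Set (Rn n)} (hD : IsOpen D)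
    (hbdry : BoundaryNondegenerate D) {e : Rn n} (he : e ∈ D₀) {δ : ℝ} (hδ : 0 < δ)
    {F : Set (Rn n)} (hF : IsCompact F) (hFD₀ : F ⊆ D₀) :
    ∃ K ⊆ D₀, IsCompact K ∧ ∃ δ' > 0, ∀ f, IsPoletskyMap D D₀ Q f → K ⊆ f '' D →
      ENNReal.ofReal δ ≤ chordalDist (toExt (D ∩ f ⁻¹' {e})) (extBoundary D) →
      ENNReal.ofReal δ' ≤ chordalDist (toExt (D ∩ f ⁻¹' F)) (extBoundary D) := by
  obtain ⟨G, hGD₀, hG, hGconn, heG, hFG⟩ :=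
    exists_isCompact_isPreconnected_superset hD₀ hD₀conn hF hFD₀ he
  obtain ⟨K, hKD₀, hK, q, hq, hring⟩ := exists_ringRatioBound hn hD₀ hQ hQint hG hGD₀
  let ι := {f : Rn n → Rn n // IsPoletskyMap D D₀ Q f ∧ K ∪ G ⊆ f '' D ∧
    ENNReal.ofReal δ ≤ chordalDist (toExt (D ∩ f ⁻¹' {e})) (extBoundary D)}
  have hdisj : Disjoint (closure (⋃ f : ι, toExt (D ∩ f.1 ⁻¹' G))) (extBoundary D) :=
    disjoint_closure_iUnion_extBoundary hD hbdry
      (fun f => hring D f.1 hD f.2.1 (subset_union_left.trans f.2.2.1))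
      (fun f => connectsTo_inter_preimage hD f.2.1.openMap f.2.1.closedMap hGconn
        (subset_union_right.trans f.2.2.1) ⟨e, heG, mem_singleton e⟩) hq
      (fun b hb => (eventually_notMem_of_le_chordalDist hb hδ).mono fun z hz f => hz _ f.2.2.2)
  obtain ⟨δ', hδ', hle⟩ := exists_pos_le_chordalDist isClosed_closure.isCompact
    isClosed_frontier.isCompact hdisj
  refine ⟨K ∪ G, union_subset hKD₀ hGD₀, hK.union hG, δ', hδ', fun f hf himage hfe => ?_⟩
  refine hle.trans (chordalDist_mono ((image_mono (inter_subset_inter_right D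
    (preimage_mono hFG))).trans ?_) _)
  exact (subset_iUnion (fun f : ι => toExt (D ∩ f.1 ⁻¹' G)) ⟨f, hf, himage, hfe⟩).trans
    subset_closure

end Uniform

end InversePoletsky

theorem lemma3p1_general {n : ℕ} (hn : 2 ≤ n) {D D₀ : Set (Rn n)} (hD : IsOpen D)
    (hbdry : BoundaryNondegenerate D) (hD₀ : IsDom D₀) {Q : Rn n → ℝ≥0∞}
    (hQ : AEMeasurable Q volume) (hQint : IntegrableOnManySpheres Q D₀) {f : ℕ → Rn n → Rn n}
    (hf : ∀ m, IsPoletskyMap D D₀ Q (f m))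
    (himage : ∀ K ⊆ D₀, IsCompact K → ∃ N, ∀ m ≥ N, K ⊆ f m '' D)
    {e : Rn n} (he : e ∈ D₀) {δ : ℝ} (hδ : 0 < δ)
    (hdist : ∀ m, ENNReal.ofReal δ ≤ chordalDist (toExt (D ∩ f m ⁻¹' {e})) (extBoundary D))
    {F : Set (Rn n)} (hF : IsCompact F) (hFD₀ : F ⊆ D₀) (hFimage : ∀ m, F ⊆ f m '' D) :
    ∃ δ' : ℝ, 0 < δ' ∧
      ∀ m, ENNReal.ofReal δ' ≤ chordalDist (toExt (D ∩ f m ⁻¹' F)) (extBoundary D) := by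
  have : NeZero n := ⟨by lia⟩
  obtain ⟨K, hKD₀, hK, δ₁, hδ₁, htail⟩ :=
    exists_le_chordalDist_preimage hn hD₀.1 hQ hQint hD₀.2 hD hbdry he hδ hF hFD₀
  obtain ⟨N, hN⟩ := himage K hKD₀ hK
  have hcompact (m : ℕ) : IsCompact (toExt (D ∩ f m ⁻¹' F)) :=
    (isCompact_inter_preimage hD (hf m).continuousOn (hf m).openMap (hf m).closedMap hF
      (hFimage m)).image OnePoint.continuous_coe
  have hdisj : Disjoint (⋃ m ∈ Iio N, toExt (D ∩ f m ⁻¹' F)) (extBoundary D) :=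
    (disjoint_toExt_extBoundary hD).mono_left
      (iUnion₂_subset fun _ _ => image_mono inter_subset_left)
  obtain ⟨δ₂, hδ₂, hhead⟩ := exists_pos_le_chordalDist
    ((finite_Iio N).isCompact_biUnion fun m _ => hcompact m) isClosed_frontier.isCompact hdisj
  refine ⟨min δ₁ δ₂, lt_min hδ₁ hδ₂, fun m => ?_⟩
  rcases lt_or_ge m N with hm | hm
  · exact (ENNReal.ofReal_le_ofReal (min_le_right _ _)).trans (hhead.trans (chordalDist_mono
      (subset_biUnion_of_mem (u := fun m => toExt (D ∩ f m ⁻¹' F)) (mem_Iio.2 hm)) _))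
  · exact (ENNReal.ofReal_le_ofReal (min_le_left _ _)).trans (htail (f m) (hf m) (hN m hm)
      (hdist m))

theorem lemma3p1 (n : ℕ) (hn : 2 ≤ n) (δ : ℝ) (hδ : 0 < δ)
    (D D₀ : Set (Rn n)) (hD : IsDom D) (hD₀ : IsDom D₀)
    (E : Set (Rn n)) (hEcompact : IsCompact E) (hEne : E.Nonempty) (hED₀ : E ⊆ D₀)
    (Q : Rn n → ℝ≥0∞) (hQmeas : AEMeasurable Q volume) (hQ0 : ∀ y ∉ D₀, Q y = 0)
    (hbdry : BoundaryNondegenerate D)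
    (f : ℕ → Rn n → Rn n) (hf : ∀ m, MemClass E Q δ D D₀ (f m))
    (A₀ : Rn n) (hker : ConvergesToKernel (fun m => f m '' D) A₀ D₀)
    (hQint : IntegrableOnManySpheres Q D₀)
    (Estar : Set (Rn n)) (hEstar : IsCompact Estar) (hEstarD₀ : Estar ⊆ D₀)
    (hEstar_image : ∀ m, Estar ⊆ f m '' D) :
    ∃ δstar : ℝ, 0 < δstar ∧
      ∀ m, ENNReal.ofReal δstar ≤
        chordalDist (toExt (D ∩ f m ⁻¹' Estar)) (extBoundary D) := by
  obtain ⟨e, he⟩ := hEne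
  exact lemma3p1_general hn hD.1 hbdry hD₀ hQmeas hQint (fun m => (hf m).isPoletskyMap)
    (hker id strictMono_id).2.1.2.2 (hED₀ he) hδ
    (fun m => (hf m).dist_preimage.trans (chordalDist_mono (image_mono
      (inter_subset_inter_right D (preimage_mono (singleton_subset_iff.2 he)))) _))
    hEstar hEstarD₀ hEstar_image
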